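/- Let $L$ be a prime alternating link different from the unknot (a prime link is, in particular, not split), and let $D$ be a reduced alternating diagram of $L$. Then $D$, regarded as a 4-regular plane graph whose vertices are the crossings, has a minimal 2-region. Here a \emph{2-region} is a connected plane graph $H$ that has a face $F$ whose boundary is a cycle $C$, such that exactly two vertices on $C$ have degree $2$ in $H$, all other vertices on $C$ have degree $3$ in $H$, and every vertex of $H$ that is not on $C$ has degree $4$ in $H$. The interior of the region $\mathbb{R}^2\setminus F$ (which may be the bounded or the unbounded region determined by $C$) is called the \emph{interior} of the 2-region. A \emph{2-region of} a plane graph $G$ is a subgraph $H$ of $G$ that is a 2-region for some such face $F$, such that every vertex and every edge of $G$ that meets the interior belongs to $H$. A 2-region $H$ is \emph{minimal} if the only 2-region of the plane graph $H$ is $H$ itself. -/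

import Mathlib

/-- A planar diagram code: finitely many crossings `X`, each with four ends numbered
counterclockwise by `ZMod 4`, the ends `0, 2` lying on the under-strand and the ends `1, 3` on the
over-strand, and finitely many arcs `A`. Every end of a crossing is an end of the arc `arc (v, i)`,
and an arc that has ends at all has exactly two. An arc without ends is a closed curve without
crossings. -/
structure PDCode where
  X : Type
  A : Type
  finite_X : Finite X
  finite_A : Finite A
  arc : X × ZMod 4 → A
  two_ends : ∀ d, ∃! e, e ≠ d ∧ arc e = arc d

namespace PDCode

variable (P : PDCode)

/-- Half-edges: pairs (crossing, position at the crossing). -/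
abbrev Dart : Type := P.X × ZMod 4

/-- The other half of the edge to which a half-edge belongs. -/
noncomputable def mate (d : P.Dart) : P.Dart := (P.two_ends d).choose

theorem mate_ne (d : P.Dart) : P.mate d ≠ d := (P.two_ends d).choose_spec.1.1

theorem arc_mate (d : P.Dart) : P.arc (P.mate d) = P.arc d := (P.two_ends d).choose_spec.1.2

theorem eq_mate (d e : P.Dart) (h : e ≠ d) (h' : P.arc e = P.arc d) : e = P.mate d :=
  (P.two_ends d).choose_spec.2 e ⟨h, h'⟩

/-- The half-edge reached from `d` by turning counterclockwise `k` times around its crossing. -/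
def turn (d : P.Dart) (k : ℕ) : P.Dart := (d.1, d.2 + (k : ZMod 4))

/-- Faces. A half-edge `d` also stands for the corner between `d` and `turn d 1`, which is the
corner to the left of `d`. The next corner of the same face, met when one walks along `d` with the
face on the left, is the corner between the half-edge before `mate d` and `mate d`. -/
def Face : Type := Quot (fun c d : P.Dart => d = P.turn (P.mate c) 3)

/-- The face that contains the corner between `d` and `turn d 1`. -/
def face (d : P.Dart) : P.Face := Quot.mk _ d

/-- Connected components of the underlying 4-regular graph on the crossings. -/
def GraphComponent : Type := Quot (fun u v : P.X => ∃ i j, P.arc (u, i) = P.arc (v, j))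

/-- Connected components of the whole diagram, closed curves without crossings included. -/
def Piece : Type := Quot (fun a b : P.A => ∃ v i j, P.arc (v, i) = a ∧ P.arc (v, j) = b)

end PDCode

/-- A (non-empty) link diagram on the sphere, up to isotopy: a planar diagram code whose faces
satisfy Euler's formula `V - E + F = 2 C`, where `E = 2 V`. As each component of the graph
contributes at most `2` to the left-hand side, this says that every component has genus zero. -/
structure LinkDiagram extends PDCode where
  nonempty : Nonempty A
  planar : Nat.card toPDCode.Face = Nat.card X + 2 * Nat.card toPDCode.GraphComponent

namespace LinkDiagram

/-- The ends `1` and `3` of a crossing lie on the strand that passes over. -/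
def IsOver (i : ZMod 4) : Prop := i = 1 ∨ i = 3

/-- Following any strand, one passes alternately over and under: the two halves of every edge
are one over-end and one under-end. -/
def IsAlternating (D : LinkDiagram) : Prop :=
  ∀ d : D.Dart, IsOver (D.mate d).2 ↔ ¬ IsOver d.2

/-- A crossing is nugatory if a simple closed curve meets the diagram only there, and crosses it
there from one corner to the opposite corner; that is, if two opposite corners lie in one face. -/
def IsNugatory (D : LinkDiagram) (v : D.X) : Prop :=
  ∃ i : ZMod 4, D.face (v, i) = D.face (v, i + 2)

/-- A diagram is reduced if it has no nugatory crossing. -/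
def IsReduced (D : LinkDiagram) : Prop := ∀ v : D.X, ¬ D.IsNugatory v

/-- A diagram is connected as a subset of the sphere. -/
def IsConnected (D : LinkDiagram) : Prop := Subsingleton D.Piece

/-! ### Links as diagrams up to Reidemeister moves -/

/-- `D` and `D'` are the same diagram up to the names of crossings and arcs and up to
half a turn of the numbering at each crossing. -/
def IsIso (D D' : LinkDiagram) : Prop :=
  ∃ (f : D.X ≃ D'.X) (g : D.A ≃ D'.A) (r : D.X → ZMod 4), (∀ v, r v = 0 ∨ r v = 2) ∧
    ∀ v i, D'.arc (f v, i + r v) = g (D.arc (v, i))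

/-- `D'` is `D` with the crossings in `S` removed: at these crossings, each of the two strands
continues straight on, so that the arcs before and after the crossing become one. -/
def IsErasure (D : LinkDiagram) (S : Set D.X) (D' : LinkDiagram) : Prop :=
  ∃ (f : D'.X ≃ {v : D.X // v ∉ S}) (q : D.A → D'.A), Function.Surjective q ∧
    (∀ a b, q a = q b ↔
      Relation.EqvGen (fun a b => ∃ v ∈ S, ∃ i, a = D.arc (v, i) ∧ b = D.arc (v, i + 2)) a b) ∧
    ∀ v i, D'.arc (v, i) = q (D.arc ((f v).1, i))

/-- First Reidemeister move: a kink (an arc whose two ends are neighbours at a crossing)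
is removed. -/
def Reidemeister1 (D D' : LinkDiagram) : Prop :=
  ∃ (v : D.X) (i : ZMod 4), D.arc (v, i) = D.arc (v, i + 1) ∧ D.IsErasure {v} D'

/-- Second Reidemeister move: the crossings `v ≠ w` are the corners of a face with two edges,
one of which runs over the other one at both crossings; the strands are pulled apart. -/
def Reidemeister2 (D D' : LinkDiagram) : Prop :=
  ∃ (v w : D.X) (i j : ZMod 4), v ≠ w ∧
    D.arc (v, i) = D.arc (w, j + 1) ∧ D.arc (v, i + 1) = D.arc (w, j) ∧
    (IsOver i ↔ IsOver (j + 1)) ∧ D.IsErasure {v, w} D'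

/-- Third Reidemeister move: the distinct crossings `p 0, p 1, p 2` are, in counterclockwise order,
the corners of a face with three edges, the `k`-th edge running from the end `i k` at `p k` to the
end `i (k + 1) + 1` at `p (k + 1)`, and one of the three strands passes over the other two. Each
of the strands is moved across the crossing of the other two: after the move, it meets the same
two crossings in the opposite order. -/
def Reidemeister3 (D D' : LinkDiagram) : Prop :=
  ∃ (f : D.X ≃ D'.X) (g : D.A ≃ D'.A) (p : ZMod 3 → D.X) (i : ZMod 3 → ZMod 4),
    Function.Injective p ∧
    (∀ k, D.arc (p k, i k) = D.arc (p (k + 1), i (k + 1) + 1)) ∧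
    (∃ k, IsOver (i k) ∧ IsOver (i (k + 1) + 1)) ∧
    (∀ v, v ∉ Set.range p → ∀ j, D'.arc (f v, j) = g (D.arc (v, j))) ∧
    ∀ k, D'.arc (f (p (k + 1)), i (k + 1) + 1) = g (D.arc (p k, i k + 2)) ∧
      D'.arc (f (p (k + 1)), i (k + 1) + 3) = g (D.arc (p k, i k)) ∧
      D'.arc (f (p k), i k + 2) = g (D.arc (p k, i k)) ∧
      D'.arc (f (p k), i k) = g (D.arc (p (k + 1), i (k + 1) + 3))

/-- One step of the equivalence of link diagrams. -/
def Move (D D' : LinkDiagram) : Prop :=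
  D.IsIso D' ∨ D.Reidemeister1 D' ∨ D.Reidemeister2 D' ∨ D.Reidemeister3 D'

/-- The crossingless diagram with one closed curve. -/
def unknotDiagram : LinkDiagram where
  X := Empty
  A := Unit
  finite_X := inferInstance
  finite_A := inferInstance
  arc := fun d => d.1.elim
  two_ends := fun d => d.1.elim
  nonempty := inferInstance
  planar := by
    have h1 : IsEmpty (PDCode.Face ⟨Empty, Unit, inferInstance, inferInstance,
        fun d => d.1.elim, fun d => d.1.elim⟩) := ⟨by rintro ⟨d⟩; exact d.1.elim⟩
    have h2 : IsEmpty (PDCode.GraphComponent ⟨Empty, Unit, inferInstance, inferInstance,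
        fun d => d.1.elim, fun d => d.1.elim⟩) := ⟨by rintro ⟨v⟩; exact v.elim⟩
    rw [Nat.card_of_isEmpty, Nat.card_of_isEmpty, Nat.card_of_isEmpty]

/-- `D` is a connected sum of `D₁` and `D₂`: the diagrams are placed side by side, an edge of `D₁`
with halves `d₁`, `d₁'` and an edge of `D₂` with halves `d₂`, `d₂'` are cut, and `d₁` is joined
to `d₂` (by a new arc that keeps the name of the first edge), `d₁'` to `d₂'` (by a new arc that
keeps the name of the second edge). -/
def IsConnectedSum (D₁ D₂ D : LinkDiagram) : Prop :=
  ∃ (f : D₁.X ⊕ D₂.X ≃ D.X) (g : D₁.A ⊕ D₂.A ≃ D.A)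
    (d₁ d₁' : D₁.Dart) (d₂ d₂' : D₂.Dart),
    d₁' = D₁.mate d₁ ∧ d₂' = D₂.mate d₂ ∧
    (∀ v i, (v, i) ≠ d₁' → D.arc (f (Sum.inl v), i) = g (Sum.inl (D₁.arc (v, i)))) ∧
    D.arc (f (Sum.inl d₁'.1), d₁'.2) = g (Sum.inr (D₂.arc d₂')) ∧
    (∀ v i, (v, i) ≠ d₂ → D.arc (f (Sum.inr v), i) = g (Sum.inr (D₂.arc (v, i)))) ∧
    D.arc (f (Sum.inr d₂.1), d₂.2) = g (Sum.inl (D₁.arc d₁))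

end LinkDiagram

/-- A link (in three-space, up to isotopy): a class of link diagrams under the equivalence relation
generated by isotopy of diagrams and the Reidemeister moves. -/
def Link : Type 1 := Quot LinkDiagram.Move

/-- The link represented by a diagram. -/
def LinkDiagram.link (D : LinkDiagram) : Link := Quot.mk _ D

namespace Link

/-- The unknot. -/
def unknot : Link := LinkDiagram.unknotDiagram.link

/-- A link is split if it has a disconnected diagram. -/
def IsSplit (L : Link) : Prop := ∃ D : LinkDiagram, D.link = L ∧ ¬ D.IsConnected

/-- A link is alternating if it has an alternating diagram. -/
def IsAlternating (L : Link) : Prop := ∃ D : LinkDiagram, D.link = L ∧ D.IsAlternating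

/-- A link is prime if it is not split and is a connected sum of two links only
if one of them is the unknot. -/
def IsPrime (L : Link) : Prop :=
  ¬ L.IsSplit ∧ ∀ D₁ D₂ D : LinkDiagram, D₁.IsConnectedSum D₂ D → D.link = L →
    D₁.link = unknot ∨ D₂.link = unknot

end Link

/-! ### Plane subgraphs and 2-regions -/

namespace PDCode

variable (P : PDCode)

/-- A set of half-edges is (the set of half-edges of) a subgraph without isolated vertices
if it consists of whole edges. Its vertices are the crossings of its half-edges. -/
def IsSubgraph (H : Set P.Dart) : Prop := ∀ d ∈ H, P.mate d ∈ H

/-- The subgraph `H` is connected. -/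
def IsConnectedSubgraph (H : Set P.Dart) : Prop :=
  ∀ d ∈ H, ∀ e ∈ H,
    Relation.ReflTransGen (fun a b => b ∈ H ∧ (b = P.mate a ∨ b.1 = a.1)) d e

/-- The degree of the vertex `v` in the subgraph `H`; a loop counts twice. -/
noncomputable def degree (H : Set P.Dart) (v : P.X) : ℕ := {i : ZMod 4 | (v, i) ∈ H}.ncard

/-- None of the next `k` half-edges after `d`, in counterclockwise order, belongs to `H`. -/
def Clear (H : Set P.Dart) (d : P.Dart) (k : ℕ) : Prop :=
  ∀ m, 1 ≤ m → m ≤ k → P.turn d m ∉ H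

/-- `e` is the half-edge of `H` that follows `d` in the counterclockwise order of the
half-edges of `H` around the vertex of `d`. -/
def Follows (H : Set P.Dart) (d e : P.Dart) : Prop :=
  e ∈ H ∧ ∃ k ≤ 3, P.Clear H d k ∧ e = P.turn d (k + 1)

/-- `e` does not belong to `H` and lies in the sector between `d` and the half-edge of `H`
that follows `d`. -/
def InSector (H : Set P.Dart) (d e : P.Dart) : Prop :=
  ∃ k, 1 ≤ k ∧ k ≤ 3 ∧ P.Clear H d k ∧ e = P.turn d k

/-- The set `F` of half-edges of `H` is the boundary walk of a face of the plane graph `H`: one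
walks along half-edges of `H` and has the face on the left. -/
def IsFaceOf (H F : Set P.Dart) : Prop :=
  ∃ d ∈ H, F = {e | Relation.ReflTransGen (fun a b => b ∈ H ∧ P.Follows H b (P.mate a)) d e}

/-- `H` is a 2-region of the connected plane graph `G` (a subgraph of the plane graph underlying the
diagram): `H` is a connected subgraph of `G`; it has a face, with boundary walk `F`, whose boundary
is a cycle (no vertex is visited twice); on this cycle, exactly two vertices have degree 2 in `H`,
and the others have degree 3; the vertices of `H` off the cycle have degree 4 in `H`; and every
vertex and every edge of `G` that is not in `H` lies in the face. Since `G` is connected, the last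
condition need only be required for the half-edges of `G` at the vertices of the cycle: those
that are not in `H` lie in the sector of the face. -/
def IsTwoRegionOf (G H : Set P.Dart) : Prop :=
  P.IsSubgraph H ∧ H ⊆ G ∧ P.IsConnectedSubgraph H ∧
  ∃ F : Set P.Dart, P.IsFaceOf H F ∧ Set.InjOn Prod.fst F ∧
    {d ∈ F | P.degree H d.1 = 2}.ncard = 2 ∧
    (∀ d ∈ F, P.degree H d.1 = 2 ∨ P.degree H d.1 = 3) ∧
    (∀ d ∈ H, d.1 ∉ Prod.fst '' F → P.degree H d.1 = 4) ∧
    ∀ d ∈ F, ∀ e ∈ G, e.1 = d.1 → e ∉ H → P.InSector H d e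

end PDCode

/-- `H` is a minimal 2-region of `D`: it is a 2-region of the plane graph of `D`, and the only
2-region of the plane graph `H` is `H` itself. -/
def LinkDiagram.IsMinimalTwoRegion (D : LinkDiagram) (H : Set D.Dart) : Prop :=
  D.IsTwoRegionOf Set.univ H ∧ ∀ H' : Set D.Dart, D.IsTwoRegionOf H H' → H' = H

/-! Call a set `S` of faces a region if it is the right side of a simple closed curve along edges
that, at each vertex, goes straight on or turns around a single corner of `S`. A strand must revisit
a crossing, and the loop so obtained bounds a region with at most one corner. Hence, among the
regions with at most two corners, there is one that is minimal under inclusion, say `S` with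
boundary `c`. The graph `H` of all edges that border `S` is the required 2-region: its vertices have
degree 2 at corners of `c`, degree 3 where `c` goes straight, and degree 4 off `c`.

Minimality of `S` is used through chords. A strand that enters `S` cannot cross itself there, so it
runs to another vertex of `c`. Each of the two arcs of `c` between its ends contains a corner, since
otherwise the chord would cut off a smaller region with at most two corners
(`IsMinimalRegion.exists_corners`). As a reduced diagram has no kinks, `c` has exactly two corners
(`IsMinimalRegion.ncard_corners`).

Now let `K` be a 2-region of `H`, bounded by a curve `g`. If `g` follows `c` wherever `K` contains
both half-edges of `c` at a vertex, then `g` bounds a region inside `S` with at most two corners,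
which must be all of `S`, and `K = H` (`IsBoundedBy.eq_of_not_departs`). If `g` departs from `c`
once, it does so all the way around (`IsBoundedBy.departs_succ`), so it visits every vertex of `c`.
At a straight vertex it then has to run along the chord; afterwards it is confined to one part of
`S` and misses a corner of `c`, a contradiction. Without straight vertices, `H` is just `c`, and `K
= H` (`IsBoundedBy.eq_of_departs`).

The sides of closed curves come from a Jordan curve theorem, `IsCurve.exists_isSide`, which follows
from Euler's formula by a dimension count in homology modulo 2. -/

namespace PDCode

variable {P : PDCode}

instance : Finite P.X := P.finite_X

instance : Finite P.A := P.finite_A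

instance : Finite P.Face := inferInstanceAs (Finite (Quot _))

/-! ### Half-edges and corners -/

@[simp] theorem mate_mate (d : P.Dart) : P.mate (P.mate d) = d :=
  (P.eq_mate (P.mate d) d (P.mate_ne d).symm (P.arc_mate d).symm).symm

theorem mate_injective : Function.Injective P.mate := fun a b h => by
  rw [← mate_mate a, h, mate_mate]

@[simp] theorem turn_fst (d : P.Dart) (k : ℕ) : (P.turn d k).1 = d.1 := rfl

@[simp] theorem turn_zero (d : P.Dart) : P.turn d 0 = d := by simp [turn]

theorem turn_turn (d : P.Dart) (j k : ℕ) : P.turn (P.turn d j) k = P.turn d (j + k) := by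
  simp [turn, add_assoc]

@[simp] theorem turn_add_four (d : P.Dart) (k : ℕ) : P.turn d (k + 4) = P.turn d k := by
  have : (4 : ZMod 4) = 0 := by decide
  simp [turn, this]

@[simp] theorem turn_four (d : P.Dart) : P.turn d 4 = d :=
  (turn_add_four d 0).trans (turn_zero d)

@[simp] theorem turn_five (d : P.Dart) : P.turn d 5 = P.turn d 1 := turn_add_four d 1

@[simp] theorem turn_six (d : P.Dart) : P.turn d 6 = P.turn d 2 := turn_add_four d 2

theorem turn_eq_turn_iff (d : P.Dart) {j k : ℕ} (hj : j < 4) (hk : k < 4) :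
    P.turn d j = P.turn d k ↔ j = k := by
  refine ⟨fun h => ?_, fun h => h ▸ rfl⟩
  have h' : ((j : ℕ) : ZMod 4) = (k : ℕ) := by simpa [turn] using h
  interval_cases j <;> interval_cases k <;> first | rfl | (exfalso; revert h'; decide)

theorem turn_ne (d : P.Dart) {k : ℕ} (h0 : 0 < k) (hk : k < 4) : P.turn d k ≠ d := by
  intro h
  have := (turn_eq_turn_iff d hk (by norm_num : 0 < 4)).1 (by simpa using h)
  omega

theorem exists_turn {d e : P.Dart} (h : e.1 = d.1) : ∃ k < 4, e = P.turn d k := by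
  obtain ⟨v, i⟩ := d
  obtain ⟨w, j⟩ := e
  obtain rfl : w = v := h
  refine ⟨(j - i).val, ZMod.val_lt _, ?_⟩
  simp [turn]

theorem eq_or_turn {d e : P.Dart} (h : e.1 = d.1) :
    e = d ∨ e = P.turn d 1 ∨ e = P.turn d 2 ∨ e = P.turn d 3 := by
  obtain ⟨k, hk, rfl⟩ := exists_turn h
  interval_cases k <;> simp

/-- The face of `mate d` lies to the right of `d`, so at the vertex of `d` it fills the corner just
before `d`. This turns crossing an edge into passing between neighbouring corners of one vertex. -/
theorem face_mate (d : P.Dart) : P.face (P.mate d) = P.face (P.turn d 3) := by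
  refine Quot.sound ?_
  rw [mate_mate]

theorem face_turn_three_mate (d : P.Dart) : P.face (P.turn (P.mate d) 3) = P.face d := by
  rw [← face_mate, mate_mate]

/-- The crossings of `P` are joined by edges. -/
def Linked (P : PDCode) : Prop :=
  ∀ u v : P.X, Relation.ReflTransGen (fun a b => ∃ d : P.Dart, d.1 = a ∧ (P.mate d).1 = b) u v

/-! ### Simple closed curves along edges -/

/-- The half-edges `c 0, …, c (n - 1)` are the consecutive steps of a closed walk of length `n`
without repeated vertices that does not turn back; `c` is continued periodically. -/
structure IsCurve (P : PDCode) (c : ℕ → P.Dart) (n : ℕ) : Prop where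
  pos : 0 < n
  periodic : ∀ i, c (i + n) = c i
  step : ∀ i, (c (i + 1)).1 = (P.mate (c i)).1
  inj : ∀ i < n, ∀ j < n, (c i).1 = (c j).1 → i = j
  noback : ∀ i, c (i + 1) ≠ P.mate (c i)

/-- The edge of `d` belongs to the walk `c`. -/
def OnCurve (P : PDCode) (c : ℕ → P.Dart) (d : P.Dart) : Prop := ∃ i, d = c i ∨ d = P.mate (c i)

/-- The set `S` of faces is the part of the sphere to the right of the closed curve `c`. -/
structure IsSide (P : PDCode) (c : ℕ → P.Dart) (S : Set P.Face) : Prop where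
  cross : ∀ d, ¬ P.OnCurve c d → (P.face d ∈ S ↔ P.face (P.mate d) ∈ S)
  left : ∀ i, P.face (c i) ∉ S
  right : ∀ i, P.face (P.mate (c i)) ∈ S

theorem onCurve_mate {c : ℕ → P.Dart} {d : P.Dart} :
    P.OnCurve c (P.mate d) ↔ P.OnCurve c d := by
  constructor
  · rintro ⟨i, h | h⟩
    · exact ⟨i, Or.inr (by rw [← h, mate_mate])⟩
    · exact ⟨i, Or.inl (mate_injective h)⟩
  · rintro ⟨i, rfl | rfl⟩
    · exact ⟨i, Or.inr rfl⟩
    · exact ⟨i, Or.inl (mate_mate _)⟩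

namespace IsCurve

variable {c : ℕ → P.Dart} {n : ℕ} (hc : P.IsCurve c n)
include hc

theorem apply_mod (i : ℕ) : c (i % n) = c i :=
  Function.Periodic.map_mod_nat (f := c) hc.periodic i

theorem mod_lt (i : ℕ) : i % n < n := Nat.mod_lt _ hc.pos

theorem mod_eq_of_fst {i j : ℕ} (h : (c i).1 = (c j).1) : i % n = j % n :=
  hc.inj _ (hc.mod_lt i) _ (hc.mod_lt j) (by rw [hc.apply_mod, hc.apply_mod, h])

theorem eq_of_fst {i j : ℕ} (h : (c i).1 = (c j).1) : c i = c j := by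
  rw [← hc.apply_mod i, ← hc.apply_mod j, hc.mod_eq_of_fst h]

theorem succ_eq {i j : ℕ} (h : c i = c j) : c (i + 1) = c (j + 1) :=
  hc.eq_of_fst (by rw [hc.step, hc.step, h])

theorem exists_pred (i : ℕ) : ∃ j, c (j + 1) = c i :=
  ⟨i + n - 1, by
    have := hc.pos
    rw [show i + n - 1 + 1 = i + n by omega, hc.periodic]⟩

theorem ne_mate (i j : ℕ) : c i ≠ P.mate (c j) := by
  intro h
  have h1 : (c i).1 = (c (j + 1)).1 := by rw [h, hc.step]
  exact hc.noback j (by rw [← hc.eq_of_fst h1, h])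

theorem onCurve_at {i : ℕ} {d : P.Dart} (hd : d.1 = (c (i + 1)).1) (h : P.OnCurve c d) :
    d = c (i + 1) ∨ d = P.mate (c i) := by
  obtain ⟨j, rfl | rfl⟩ := h
  · exact Or.inl (hc.eq_of_fst hd)
  · refine Or.inr ?_
    rw [← hc.step] at hd
    obtain h := hc.mod_eq_of_fst hd
    have h' : j % n = i % n := Nat.ModEq.add_right_cancel' 1 h
    rw [← hc.apply_mod i, ← hc.apply_mod j, h']

end IsCurve

/-! ### Every closed curve on the sphere has two sides -/

open Classical in
-- Only arcs with ends count, so closed curves without crossings play no role; each such arc takes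
-- two of the `4 V` half-edges.
theorem card_range_arc (P : PDCode) : Nat.card (Set.range P.arc) = 2 * Nat.card P.X := by
  have := Fintype.ofFinite P.X
  have := Fintype.ofFinite P.A
  have h : ∀ a ∈ (Finset.univ.image P.arc), (Finset.univ.filter fun d => P.arc d = a).card = 2 := by
    intro a ha
    obtain ⟨d, -, rfl⟩ := Finset.mem_image.1 ha
    rw [Finset.card_eq_two]
    refine ⟨d, P.mate d, (P.mate_ne d).symm, ?_⟩
    ext e
    simp only [Finset.mem_filter, Finset.mem_univ, true_and, Finset.mem_insert,
      Finset.mem_singleton]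
    refine ⟨fun h => or_iff_not_imp_left.2 fun hne => P.eq_mate d e hne h, ?_⟩
    rintro (rfl | rfl)
    · rfl
    · exact P.arc_mate d
  have h1 := Finset.card_eq_sum_card_image P.arc Finset.univ
  rw [Finset.sum_const_nat h, Finset.card_univ, Fintype.card_prod, ZMod.card] at h1
  have h2 : Nat.card (Set.range P.arc) = (Finset.univ.image P.arc).card := by
    rw [← Set.ncard_coe_finset, Finset.coe_image, Finset.coe_univ, Set.image_univ]
    rfl
  rw [h2, Nat.card_eq_fintype_card]
  omega

/-- The edge of a half-edge. -/
def edge (d : P.Dart) : Set.range P.arc := ⟨P.arc d, d, rfl⟩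

theorem edge_eq_iff {d e : P.Dart} : edge d = edge e ↔ d = e ∨ d = P.mate e := by
  refine Subtype.ext_iff.trans ?_
  change P.arc d = P.arc e ↔ _
  refine ⟨fun h => or_iff_not_imp_left.2 fun hne => P.eq_mate e d hne h, ?_⟩
  rintro (rfl | rfl)
  · rfl
  · exact P.arc_mate e

theorem edge_surjective (x : Set.range P.arc) : ∃ d : P.Dart, edge d = x := by
  obtain ⟨a, d, rfl⟩ := x
  exact ⟨d, rfl⟩

/-- The boundary of a chain of edges modulo 2. -/
noncomputable def vertexBoundary (P : PDCode) :
    (Set.range P.arc → ZMod 2) →ₗ[ZMod 2] (P.X → ZMod 2) where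
  toFun z v := ∑ i : ZMod 4, z (edge (v, i))
  map_add' z w := by
    ext v
    simp [Finset.sum_add_distrib]
  map_smul' a z := by
    ext v
    simp [Finset.mul_sum]

/-- The boundary of a chain of faces modulo 2. -/
noncomputable def edgeBoundary (P : PDCode) :
    (P.Face → ZMod 2) →ₗ[ZMod 2] (Set.range P.arc → ZMod 2) where
  toFun s x := s (P.face (edge_surjective x).choose) +
    s (P.face (P.mate (edge_surjective x).choose))
  map_add' z w := by
    ext v
    simp only [Pi.add_apply]
    ring
  map_smul' a z := by
    ext v
    simp [mul_add]

theorem edgeBoundary_edge (s : P.Face → ZMod 2) (d : P.Dart) :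
    P.edgeBoundary s (edge d) = s (P.face d) + s (P.face (P.mate d)) := by
  change s (P.face (edge_surjective (edge d)).choose) +
    s (P.face (P.mate (edge_surjective (edge d)).choose)) = _
  have h := (edge_surjective (edge d)).choose_spec
  rcases edge_eq_iff.1 h with h | h
  · rw [h]
  · rw [h, mate_mate, add_comm]

/-- Each corner at a vertex lies beside two half-edges there and is counted twice. -/
theorem vertexBoundary_edgeBoundary (s : P.Face → ZMod 2) :
    P.vertexBoundary (P.edgeBoundary s) = 0 := by
  ext v
  change ∑ i : ZMod 4, P.edgeBoundary s (edge (v, i)) = 0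
  simp_rw [edgeBoundary_edge, face_mate]
  rw [Finset.sum_add_distrib]
  have h : ∑ i : ZMod 4, s (P.face (P.turn (v, i) 3)) = ∑ i : ZMod 4, s (P.face (v, i)) :=
    Equiv.sum_comp (Equiv.addRight (3 : ZMod 4)) (fun i => s (P.face (v, i)))
  rw [h, CharTwo.add_self_eq_zero]

open Classical in
theorem vertexBoundary_single (d : P.Dart) :
    P.vertexBoundary (Pi.single (edge d) 1) = Pi.single d.1 1 + Pi.single (P.mate d).1 1 := by
  ext w
  change ∑ i : ZMod 4, (Pi.single (edge d) 1 : Set.range P.arc → ZMod 2) (edge (w, i)) = _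
  have h : ∀ i : ZMod 4, (Pi.single (edge d) 1 : Set.range P.arc → ZMod 2) (edge (w, i)) =
      (if d = (w, i) then 1 else 0) + (if P.mate d = (w, i) then 1 else 0) := by
    intro i
    have hd := P.mate_ne d
    simp only [Pi.single_apply, edge_eq_iff]
    by_cases h1 : d = (w, i)
    · rw [← h1]
      simp [hd]
    · by_cases h2 : P.mate d = (w, i)
      · rw [← h2]
        simp [hd.symm]
      · simp [h1, h2, Ne.symm h1, Ne.symm h2]
  have h' : ∀ e : P.Dart, ∑ i : ZMod 4, (if e = (w, i) then (1 : ZMod 2) else 0) =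
      (Pi.single e.1 1 : P.X → ZMod 2) w := by
    rintro ⟨v, j⟩
    by_cases hv : v = w
    · subst hv
      simp
    · simp [Ne.symm hv, hv]
  rw [Finset.sum_congr rfl fun i _ => h i, Finset.sum_add_distrib, h', h', Pi.add_apply]

/-- A chain of faces without boundary takes equal values across each edge, hence at all corners of a
vertex, hence at adjacent vertices; connectedness does the rest. -/
theorem ker_edgeBoundary_le (hl : P.Linked) {s : P.Face → ZMod 2} (hs : P.edgeBoundary s = 0)
    (d e : P.Dart) : s (P.face d) = s (P.face e) := by
  have h0 : ∀ d, s (P.face d) = s (P.face (P.mate d)) := fun d => by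
    have h := edgeBoundary_edge s d
    rw [hs] at h
    exact CharTwo.add_eq_zero.1 h.symm
  have h3 : ∀ d, s (P.face (P.turn d 3)) = s (P.face d) := fun d => by rw [h0 d, face_mate]
  have hv : ∀ d e : P.Dart, e.1 = d.1 → s (P.face e) = s (P.face d) := by
    intro d e h
    have h2 : s (P.face (P.turn d 2)) = s (P.face d) := by
      have := h3 (P.turn d 3)
      rw [turn_turn, turn_six, h3] at this
      exact this
    have h1 : s (P.face (P.turn d 1)) = s (P.face d) := by
      have := h3 (P.turn d 2)
      rw [turn_turn, turn_five, h2] at this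
      exact this
    rcases eq_or_turn h with rfl | rfl | rfl | rfl
    · rfl
    · exact h1
    · exact h2
    · exact h3 d
  suffices H : ∀ u v : P.X, Relation.ReflTransGen
      (fun a b => ∃ d : P.Dart, d.1 = a ∧ (P.mate d).1 = b) u v →
      ∀ d e : P.Dart, d.1 = u → e.1 = v → s (P.face d) = s (P.face e) from
    H _ _ (hl d.1 e.1) d e rfl rfl
  intro u v h
  induction h with
  | refl => exact fun d e hd he => hv _ _ (hd.trans he.symm)
  | tail _ h ih =>
    intro d e hd he
    obtain ⟨g, hg, hg'⟩ := h
    rw [ih d g hd hg, h0, hv _ e (he.trans hg'.symm)]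

open Classical in
/-- On the sphere, every cycle modulo 2 is a boundary. -/
theorem ker_vertexBoundary_le (hl : P.Linked) (hX : Nonempty P.X)
    (hcard : Nat.card P.Face = Nat.card P.X + 2) :
    LinearMap.ker P.vertexBoundary ≤ LinearMap.range P.edgeBoundary := by
  have := Fintype.ofFinite P.X
  have := Fintype.ofFinite P.Face
  have := Fintype.ofFinite (Set.range P.arc)
  obtain ⟨v₀⟩ := hX
  have hE : Fintype.card (Set.range P.arc) = 2 * Fintype.card P.X := by
    rw [← Nat.card_eq_fintype_card, card_range_arc, Nat.card_eq_fintype_card]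
  have hF : Fintype.card P.Face = Fintype.card P.X + 2 := by
    rw [← Nat.card_eq_fintype_card, hcard, Nat.card_eq_fintype_card]
  -- With `E = 2 V` and `F = V + 2`, the boundaries have dimension at least `F - 1 = V + 1` and the
  -- cycles at most `E - (V - 1) = V + 1`. As boundaries are cycles, the two spaces coincide.
  have h1 := LinearMap.finrank_range_add_finrank_ker P.edgeBoundary
  have h2 := LinearMap.finrank_range_add_finrank_ker P.vertexBoundary
  rw [Module.finrank_fintype_fun_eq_card] at h1 h2
  have h3 : Module.finrank (ZMod 2) (LinearMap.ker P.edgeBoundary) ≤ 1 := by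
    have hle : LinearMap.ker P.edgeBoundary ≤ Submodule.span (ZMod 2) {fun _ => 1} := by
      intro s hs
      rw [Submodule.mem_span_singleton]
      refine ⟨s (P.face (v₀, 0)), ?_⟩
      ext f
      obtain ⟨d, rfl⟩ : ∃ d, P.face d = f := Quot.exists_rep f
      simpa using ker_edgeBoundary_le hl hs _ _
    refine (Submodule.finrank_mono hle).trans ?_
    simpa using finrank_span_le_card (R := ZMod 2) {(fun _ => 1 : P.Face → ZMod 2)}
  -- Modulo boundaries of edges all vertices of the connected graph agree, so the image together
  -- with one vertex spans everything.
  have h4 : Fintype.card P.X ≤ Module.finrank (ZMod 2) (LinearMap.range P.vertexBoundary) + 1 := by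
    set U : Submodule (ZMod 2) (P.X → ZMod 2) :=
      LinearMap.range P.vertexBoundary ⊔ Submodule.span (ZMod 2) {Pi.single v₀ 1} with hU
    have hall : ∀ v, (Pi.single v 1 : P.X → ZMod 2) ∈ U := by
      intro v
      induction hl v₀ v with
      | refl => exact Submodule.mem_sup_right (Submodule.mem_span_singleton_self _)
      | tail _ h ih =>
        obtain ⟨d, rfl, rfl⟩ := h
        have hd : P.vertexBoundary (Pi.single (edge d) 1) ∈ U :=
          Submodule.mem_sup_left (LinearMap.mem_range_self _ _)
        rw [vertexBoundary_single] at hd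
        exact (Submodule.add_mem_iff_right _ ih).1 hd
    have htop : U = ⊤ := by
      rw [eq_top_iff]
      intro z _
      rw [← Finset.univ_sum_single z]
      refine Submodule.sum_mem _ fun v _ => ?_
      have : (Pi.single v (z v) : P.X → ZMod 2) = z v • Pi.single v 1 := by
        rw [← Pi.single_smul, smul_eq_mul, mul_one]
      rw [this]
      exact Submodule.smul_mem _ _ (hall v)
    have h5 := Submodule.finrank_add_le_finrank_add_finrank (LinearMap.range P.vertexBoundary)
      (Submodule.span (ZMod 2) {(Pi.single v₀ 1 : P.X → ZMod 2)})
    rw [← hU, htop, finrank_top, Module.finrank_fintype_fun_eq_card] at h5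
    refine h5.trans (Nat.add_le_add_left ?_ _)
    simpa using finrank_span_le_card (R := ZMod 2) {(Pi.single v₀ 1 : P.X → ZMod 2)}
  have hle : LinearMap.range P.edgeBoundary ≤ LinearMap.ker P.vertexBoundary := by
    rintro _ ⟨s, rfl⟩
    exact vertexBoundary_edgeBoundary s
  exact (Submodule.eq_of_le_of_finrank_le hle (by omega)).ge

open Classical in
/-- A combinatorial Jordan curve theorem. -/
theorem IsCurve.exists_isSide (hl : P.Linked) (hX : Nonempty P.X)
    (hcard : Nat.card P.Face = Nat.card P.X + 2) {c : ℕ → P.Dart} {n : ℕ} (hc : P.IsCurve c n) :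
    ∃ S, P.IsSide c S := by
  -- `z` is the curve as a chain modulo 2, a cycle by telescoping. A chain `s` of faces with
  -- boundary `z` jumps exactly across the edges of the curve, so its two level sets are the sides.
  set z : Set.range P.arc → ZMod 2 := ∑ i ∈ Finset.range n, Pi.single (edge (c i)) 1 with hz
  have hz0 : z ∈ LinearMap.ker P.vertexBoundary := by
    rw [LinearMap.mem_ker, hz, map_sum]
    ext w
    have h : ∀ i, (P.vertexBoundary (Pi.single (edge (c i)) 1)) w =
        (Pi.single (c (i + 1)).1 1 : P.X → ZMod 2) w -
          (Pi.single (c i).1 1 : P.X → ZMod 2) w := by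
      intro i
      rw [vertexBoundary_single, hc.step, CharTwo.sub_eq_add, add_comm, Pi.add_apply]
    rw [Finset.sum_apply, Finset.sum_congr rfl fun i _ => h i,
      Finset.sum_range_sub (fun i => (Pi.single (c i).1 1 : P.X → ZMod 2) w)]
    have := hc.periodic 0
    rw [zero_add] at this
    simp [this]
  obtain ⟨s, hs⟩ := ker_vertexBoundary_le hl hX hcard hz0
  have hval : ∀ d, s (P.face d) + s (P.face (P.mate d)) =
      ∑ i ∈ Finset.range n, if edge d = edge (c i) then 1 else 0 := by
    intro d
    rw [← edgeBoundary_edge, hs, hz, Finset.sum_apply]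
    simp_rw [Pi.single_apply]
  have hoff : ∀ d, ¬ P.OnCurve c d → s (P.face d) = s (P.face (P.mate d)) := by
    intro d hd
    have h := hval d
    rw [Finset.sum_eq_zero] at h
    · exact CharTwo.add_eq_zero.1 h
    · intro i _
      rw [if_neg]
      exact fun h => hd ⟨i, edge_eq_iff.1 h⟩
  have hon : ∀ j, s (P.face (P.mate (c j))) = s (P.face (c j)) + 1 := by
    intro j
    have h := hval (c j)
    rw [Finset.sum_eq_single (j % n)] at h
    · rw [hc.apply_mod, if_pos rfl] at h
      rw [← h, ← add_assoc, CharTwo.add_self_eq_zero, zero_add]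
    · intro i hi hne
      rw [if_neg]
      intro h
      rcases edge_eq_iff.1 h with h | h
      · refine hne ?_
        rw [← Nat.mod_eq_of_lt (Finset.mem_range.1 hi)]
        exact hc.mod_eq_of_fst (by rw [h])
      · exact hc.ne_mate _ _ h
    · intro h
      exact absurd (Finset.mem_range.2 (hc.mod_lt j)) h
  -- From the left of one step to the left of the next one sweeps clockwise around their common
  -- vertex, only over half-edges off the curve. So all faces on the left carry the same value.
  have hleft : ∀ i, s (P.face (c i)) = s (P.face (c 0)) := by
    intro i
    induction i with
    | zero => rfl
    | succ i ih =>
      rw [← ih, ← face_turn_three_mate (c i)]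
      set m := P.mate (c i) with hm
      have hoff' : ∀ k, k < 4 → 0 < k → P.turn m k ≠ c (i + 1) →
          s (P.face (P.turn m k)) = s (P.face (P.turn m (k + 3))) := by
        intro k hk hk0 h
        rw [hoff, face_mate, turn_turn]
        intro h'
        rcases hc.onCurve_at (i := i) (by rw [turn_fst, hc.step]) h' with h' | h'
        · exact h h'
        · exact turn_ne m hk0 hk h'
      obtain ⟨k, hk, hk'⟩ := exists_turn (hc.step i)
      have hne : ∀ j, j < 4 → j ≠ k → P.turn m j ≠ c (i + 1) := fun j hj hjk h =>
        hjk ((turn_eq_turn_iff m hj hk).1 (h.trans hk'))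
      have hk0 : k ≠ 0 := by
        rintro rfl
        exact hc.noback i (by rw [hk', turn_zero])
      rw [hk']
      have h3 := hoff' 3 (by norm_num) (by norm_num)
      have h2 := hoff' 2 (by norm_num) (by norm_num)
      simp only [Nat.reduceAdd, turn_five, turn_six] at h2 h3
      interval_cases k
      · exact absurd rfl hk0
      · rw [h3 (hne 3 (by norm_num) (by norm_num)), h2 (hne 2 (by norm_num) (by norm_num))]
      · rw [h3 (hne 3 (by norm_num) (by norm_num))]
      · rfl
  refine ⟨{f | s f ≠ s (P.face (c 0))}, ⟨fun d hd => ?_, fun i => ?_, fun i => ?_⟩⟩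
  · change _ ≠ _ ↔ _ ≠ _
    rw [hoff d hd]
  · simp [hleft i]
  · change _ ≠ _
    rw [hon, hleft]
    simp

/-! ### Periodic continuation, change of starting point -/

theorem mod_succ_cases {N : ℕ} (hN : 0 < N) (i : ℕ) :
    ((i + 1) % N = i % N + 1 ∧ i % N + 1 < N) ∨ ((i + 1) % N = 0 ∧ i % N = N - 1) := by
  have h := Nat.mod_lt i hN
  rcases Nat.lt_or_ge (i % N + 1) N with h1 | h1
  · refine Or.inl ⟨?_, h1⟩
    rw [Nat.add_mod_eq_ite, Nat.mod_eq_of_lt (show 1 < N by omega), if_neg (by omega)]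
  · refine Or.inr ⟨?_, by omega⟩
    rw [← Nat.mod_add_mod, show i % N + 1 = N by omega, Nat.mod_self]

theorem isCurve_periodize {f : ℕ → P.Dart} {N : ℕ} (hN : 0 < N)
    (hstep : ∀ i, i + 1 < N → (f (i + 1)).1 = (P.mate (f i)).1 ∧ f (i + 1) ≠ P.mate (f i))
    (hwrap : (f 0).1 = (P.mate (f (N - 1))).1 ∧ f 0 ≠ P.mate (f (N - 1)))
    (hinj : ∀ i < N, ∀ j < N, (f i).1 = (f j).1 → i = j) :
    P.IsCurve (fun i => f (i % N)) N := by
  have h : ∀ i, (f ((i + 1) % N)).1 = (P.mate (f (i % N))).1 ∧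
      f ((i + 1) % N) ≠ P.mate (f (i % N)) := by
    intro i
    rcases mod_succ_cases hN i with ⟨h1, h2⟩ | ⟨h1, h2⟩
    · rw [h1]
      exact hstep _ h2
    · rw [h1, h2]
      exact hwrap
  refine ⟨hN, fun i => by simp, fun i => (h i).1, fun i hi j hj hij => ?_, fun i => (h i).2⟩
  rw [Nat.mod_eq_of_lt hi, Nat.mod_eq_of_lt hj] at hij
  exact hinj i hi j hj hij

theorem IsCurve.shift {c : ℕ → P.Dart} {n : ℕ} (hc : P.IsCurve c n) (k : ℕ) :
    P.IsCurve (fun i => c (k + i)) n := by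
  refine ⟨hc.pos, fun i => by rw [← add_assoc, hc.periodic], fun i => hc.step (k + i), fun i hi j hj h => ?_,
    fun i => hc.noback (k + i)⟩
  have h' := hc.mod_eq_of_fst h
  have h'' : i % n = j % n := Nat.ModEq.add_left_cancel' k h'
  rwa [Nat.mod_eq_of_lt hi, Nat.mod_eq_of_lt hj] at h''

theorem IsCurve.exists_shift {c : ℕ → P.Dart} {n : ℕ} (hc : P.IsCurve c n) (k s : ℕ) :
    ∃ i < n, c (k + i) = c s ∧ (k + i) % n = s % n := by
  -- The multiple `k * n` keeps the subtraction of `k` from truncating and does not matter modulo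
  -- `n`.
  have hk : k ≤ k * n := Nat.le_mul_of_pos_right k hc.pos
  have h : (k + (s + k * n - k) % n) % n = s % n := by
    rw [Nat.add_mod_mod, show k + (s + k * n - k) = s + k * n by omega, Nat.add_mul_mod_self_right]
  refine ⟨(s + k * n - k) % n, hc.mod_lt _, ?_, h⟩
  rw [← hc.apply_mod, h, hc.apply_mod]

theorem IsCurve.onCurve_shift {c : ℕ → P.Dart} {n : ℕ} (hc : P.IsCurve c n) (k : ℕ) {d : P.Dart} :
    P.OnCurve (fun i => c (k + i)) d ↔ P.OnCurve c d := by
  constructor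
  · rintro ⟨i, h⟩
    exact ⟨k + i, h⟩
  · rintro ⟨i, h⟩
    obtain ⟨j, -, hj, -⟩ := hc.exists_shift k i
    exact ⟨j, by simpa only [hj] using h⟩

theorem IsCurve.exists_fst_of_onCurve {c : ℕ → P.Dart} {n : ℕ} (hc : P.IsCurve c n) {d : P.Dart}
    (h : P.OnCurve c d) : ∃ i, (c i).1 = d.1 := by
  obtain ⟨i, rfl | rfl⟩ := h
  · exact ⟨i, rfl⟩
  · exact ⟨i + 1, hc.step i⟩

/-! ### Sides of curves near a vertex -/

namespace IsSide

variable {c : ℕ → P.Dart} {n : ℕ} {S : Set P.Face} (hS : P.IsSide c S)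
include hS

theorem turn_three {d : P.Dart} (hd : ¬ P.OnCurve c d) :
    P.face (P.turn d 3) ∈ S ↔ P.face d ∈ S := by
  rw [← face_mate, hS.cross d hd]

theorem constant_of_not_onCurve {d e : P.Dart} (hd : ∀ e : P.Dart, e.1 = d.1 → ¬ P.OnCurve c e)
    (he : e.1 = d.1) : P.face e ∈ S ↔ P.face d ∈ S := by
  have h3 : ∀ k, P.face (P.turn d (k + 3)) ∈ S ↔ P.face (P.turn d k) ∈ S := fun k => by
    rw [← turn_turn, hS.turn_three (hd (P.turn d k) rfl)]
  have h0 := h3 0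
  have h2 := h3 3
  have h1 := h3 2
  simp only [Nat.reduceAdd, turn_zero, turn_five, turn_six] at h0 h1 h2
  rcases eq_or_turn he with rfl | rfl | rfl | rfl <;> tauto

theorem constant (hc : P.IsCurve c n) {d e : P.Dart} (hd : ∀ i, (c i).1 ≠ d.1) (he : e.1 = d.1) :
    P.face e ∈ S ↔ P.face d ∈ S := by
  refine hS.constant_of_not_onCurve (fun e he h => ?_) he
  obtain ⟨i, hi⟩ := hc.exists_fst_of_onCurve h
  exact hd i (hi.trans he)

theorem turn_mate_three (i : ℕ) : P.face (P.turn (P.mate (c i)) 3) ∉ S := by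
  rw [face_turn_three_mate]
  exact hS.left i

/-- The half-edge `turn 3` is off the curve, so the two corners beside it lie on the same side, the
left one. -/
theorem corner_two (hc : P.IsCurve c n) {i : ℕ} (h : c (i + 1) = P.turn (P.mate (c i)) 1) :
    P.face (P.turn (P.mate (c i)) 2) ∉ S := by
  have h3 : ¬ P.OnCurve c (P.turn (P.mate (c i)) 3) := by
    intro h'
    rcases hc.onCurve_at (i := i) ((turn_fst _ _).trans (hc.step i).symm) h' with h' | h'
    · rw [h, turn_eq_turn_iff _ (by norm_num) (by norm_num)] at h'
      omega
    · exact turn_ne _ (by norm_num) (by norm_num) h'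
  have := hS.turn_three h3
  rw [turn_turn, turn_six] at this
  rw [this]
  exact hS.turn_mate_three i

/-- The half-edge `turn 1`, to the right of a straight passage, is off the curve, so both corners
beside it lie in `S`. This is where a strand enters the region. -/
theorem straight_one (hc : P.IsCurve c n) {i : ℕ} (h : c (i + 1) = P.turn (P.mate (c i)) 2) :
    P.face (P.turn (P.mate (c i)) 1) ∈ S := by
  have h3 : ¬ P.OnCurve c (P.turn (P.mate (c i)) 1) := by
    intro h'
    rcases hc.onCurve_at (i := i) ((turn_fst _ _).trans (hc.step i).symm) h' with h' | h'
    · rw [h, turn_eq_turn_iff _ (by norm_num) (by norm_num)] at h'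
      omega
    · exact turn_ne _ (by norm_num) (by norm_num) h'
  have := hS.turn_three h3
  rw [turn_turn, turn_four] at this
  rw [← this]
  exact hS.right i

end IsSide

/-! ### Regions bounded by straight arcs with convex corners -/

/-- `S` is the side of the closed curve `c`; at each of its vertices the curve either
goes straight on or turns around one corner that belongs to `S`. -/
structure IsRegion (P : PDCode) (c : ℕ → P.Dart) (n : ℕ) (S : Set P.Face) : Prop where
  curve : P.IsCurve c n
  side : P.IsSide c S
  turns : ∀ i, c (i + 1) = P.turn (P.mate (c i)) 1 ∨ c (i + 1) = P.turn (P.mate (c i)) 2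

/-- The steps of `c` that follow a corner. -/
def corners (P : PDCode) (c : ℕ → P.Dart) : Set P.Dart :=
  {d | ∃ i, d = c (i + 1) ∧ c (i + 1) = P.turn (P.mate (c i)) 1}

/-- Every simple closed curve has sides. -/
def HasSides (P : PDCode) : Prop := ∀ c n, P.IsCurve c n → ∃ S, P.IsSide c S

theorem not_corner_of_straight {c : ℕ → P.Dart} {i : ℕ} (h : c (i + 1) = P.turn (P.mate (c i)) 2) :
    c (i + 1) ≠ P.turn (P.mate (c i)) 1 := by
  rw [h, Ne, turn_eq_turn_iff _ (by norm_num) (by norm_num)]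
  omega

theorem IsRegion.shift {c : ℕ → P.Dart} {n : ℕ} {S : Set P.Face} (hR : P.IsRegion c n S) (k : ℕ) :
    P.IsRegion (fun i => c (k + i)) n S := by
  refine ⟨hR.curve.shift k, ⟨fun d hd => hR.side.cross d ?_, fun i => hR.side.left _,
    fun i => hR.side.right _⟩, fun i => hR.turns _⟩
  rwa [hR.curve.onCurve_shift] at hd

theorem IsCurve.corners_shift {c : ℕ → P.Dart} {n : ℕ} (hc : P.IsCurve c n) (k : ℕ) :
    P.corners (fun i => c (k + i)) = P.corners c := by
  ext d
  constructor
  · rintro ⟨i, h⟩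
    exact ⟨k + i, h⟩
  · rintro ⟨i, h⟩
    obtain ⟨j, -, hj, -⟩ := hc.exists_shift k i
    have hj' := hc.succ_eq hj
    refine ⟨j, ?_⟩
    change d = c (k + j + 1) ∧ c (k + j + 1) = P.turn (P.mate (c (k + j))) 1
    rwa [hj', hj]

/-! ### Walking straight on -/

/-- The next half-edge on the strand. -/
noncomputable def straight (P : PDCode) (d : P.Dart) : P.Dart := P.turn (P.mate d) 2

theorem straight_fst (d : P.Dart) : (P.straight d).1 = (P.mate d).1 := rfl

theorem straight_ne_mate (d : P.Dart) : P.straight d ≠ P.mate d :=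
  turn_ne _ (by norm_num) (by norm_num)

theorem mate_eq_turn_straight (d : P.Dart) : P.mate d = P.turn (P.straight d) 2 := by
  rw [straight, turn_turn, turn_four]

theorem straight_mate_straight (d : P.Dart) : P.straight (P.mate (P.straight d)) = P.mate d := by
  rw [straight, mate_mate, ← mate_eq_turn_straight]

theorem iterate_succ_fst (d : P.Dart) (j : ℕ) :
    (P.straight^[j + 1] d).1 = (P.mate (P.straight^[j] d)).1 := by
  rw [Function.iterate_succ_apply', straight_fst]

theorem iterate_reverse (d : P.Dart) {N j : ℕ} (h : j ≤ N) :
    P.straight^[j] (P.mate (P.straight^[N] d)) = P.mate (P.straight^[N - j] d) := by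
  induction j with
  | zero => rfl
  | succ j ih =>
    rw [Function.iterate_succ_apply', ih (by omega), show N - j = N - (j + 1) + 1 by omega,
      Function.iterate_succ_apply', straight_mate_straight]

theorem iterate_reverse_fst (d : P.Dart) {N j : ℕ} (h : j ≤ N) :
    (P.straight^[j] (P.mate (P.straight^[N] d))).1 = (P.straight^[N - j + 1] d).1 := by
  rw [iterate_reverse d h, iterate_succ_fst]

/-- Walking along a strand until one reaches `B` or a crossing visited before. -/
theorem exists_walk (d : P.Dart) (B : Set P.X) :
    ∃ N, 0 < N ∧
      (∀ i < N, ∀ j < N, (P.straight^[i] d).1 = (P.straight^[j] d).1 → i = j) ∧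
      (∀ i, 0 < i → i < N → (P.straight^[i] d).1 ∉ B) ∧
      ((P.straight^[N] d).1 ∈ B ∨
        (P.straight^[N] d).1 ∉ B ∧ ∃ k < N, (P.straight^[N] d).1 = (P.straight^[k] d).1) := by
  classical
  have hex : ∃ N, 0 < N ∧ ((P.straight^[N] d).1 ∈ B ∨
      ∃ k < N, (P.straight^[N] d).1 = (P.straight^[k] d).1) := by
    obtain ⟨i, j, hij, h⟩ := Finite.exists_ne_map_eq_of_infinite fun i => (P.straight^[i] d).1
    rcases lt_or_gt_of_ne hij with h' | h'
    · exact ⟨j, by omega, Or.inr ⟨i, h', h.symm⟩⟩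
    · exact ⟨i, by omega, Or.inr ⟨j, h', h⟩⟩
  have hmin : ∀ j, 0 < j → j < Nat.find hex → (P.straight^[j] d).1 ∉ B ∧
      ∀ k < j, (P.straight^[j] d).1 ≠ (P.straight^[k] d).1 := by
    intro j h0 hj
    have := Nat.find_min hex hj
    push Not at this
    exact this h0
  obtain ⟨h0, h⟩ := Nat.find_spec hex
  refine ⟨Nat.find hex, h0, fun i hi j hj hij => ?_, fun i h0 hi => (hmin i h0 hi).1, ?_⟩
  · by_contra hne
    rcases lt_or_gt_of_ne hne with h' | h'
    · exact (hmin j (by omega) hj).2 i h' hij.symm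
    · exact (hmin i (by omega) hi).2 j h' hij
  · tauto

/-- Returning through its own first half-edge, the strand would traverse the first edge backwards
and so visit the second vertex again; by injectivity this happens at step 1 at the latest, where the
strand would have to turn back. -/
theorem mate_iterate_ne {d : P.Dart} {N : ℕ}
    (hinj : ∀ i < N + 1, ∀ j < N + 1, (P.straight^[i] d).1 = (P.straight^[j] d).1 → i = j) :
    P.mate (P.straight^[N] d) ≠ d := by
  intro h
  have h' : P.straight^[N] d = P.mate d := by rw [← mate_mate (P.straight^[N] d), h]
  rcases Nat.eq_zero_or_pos N with rfl | hN
  · exact P.mate_ne d h'.symm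
  · have := hinj N (by omega) 1 (by omega) (by rw [h']; rfl)
    subst this
    exact straight_ne_mate d h'

theorem isCurve_of_walk {d : P.Dart} {N : ℕ}
    (hinj : ∀ i < N + 1, ∀ j < N + 1, (P.straight^[i] d).1 = (P.straight^[j] d).1 → i = j)
    (hN : (P.mate (P.straight^[N] d)).1 = d.1) :
    P.IsCurve (fun i => P.straight^[i % (N + 1)] d) (N + 1) := by
  refine isCurve_periodize (f := fun i => P.straight^[i] d) (by omega) (fun i _ => ?_)
    ⟨hN.symm, (mate_iterate_ne hinj).symm⟩ hinj
  rw [Function.iterate_succ_apply']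
  exact ⟨rfl, straight_ne_mate _⟩

/-- A closing turn to the left is left out here; `exists_curve_of_walk` reduces it to a right turn
by walking backwards. -/
theorem exists_curve_of_walk_aux {d : P.Dart} {N : ℕ}
    (hinj : ∀ i < N + 1, ∀ j < N + 1, (P.straight^[i] d).1 = (P.straight^[j] d).1 → i = j)
    (hN : d = P.turn (P.mate (P.straight^[N] d)) 1 ∨ d = P.turn (P.mate (P.straight^[N] d)) 2) :
    ∃ c n, P.IsCurve c n ∧
      (∀ i, c (i + 1) = P.turn (P.mate (c i)) 1 ∨ c (i + 1) = P.turn (P.mate (c i)) 2) ∧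
      P.corners c ⊆ {d} ∧ (∀ i, ∃ j ≤ N, c i = P.straight^[j] d) ∧
      (c (N + 1) = d ∧ c N = P.straight^[N] d) := by
  have hc := isCurve_of_walk hinj (by rcases hN with h | h <;> conv_rhs => rw [h, turn_fst])
  have hs : ∀ i, (i + 1) % (N + 1) = i % (N + 1) + 1 →
      P.straight^[(i + 1) % (N + 1)] d = P.turn (P.mate (P.straight^[i % (N + 1)] d)) 2 := by
    intro i hi
    rw [hi, Function.iterate_succ_apply', straight]
  refine ⟨_, _, hc, fun i => ?_, ?_, fun i => ⟨i % (N + 1), ?_, rfl⟩, ?_, ?_⟩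
  · rcases mod_succ_cases (Nat.add_one_pos N) i with ⟨h1, h2⟩ | ⟨h1, h2⟩
    · exact Or.inr (hs i h1)
    · rw [Nat.add_sub_cancel] at h2
      simpa only [h1, h2, Function.iterate_zero, id] using hN
  · rintro e ⟨i, rfl, h⟩
    rcases mod_succ_cases (Nat.add_one_pos N) i with ⟨h1, h2⟩ | ⟨h1, h2⟩
    · exact absurd h (not_corner_of_straight (c := fun i => P.straight^[i % (N + 1)] d) (hs i h1))
    · simp [h1]
  · have := Nat.mod_lt i (Nat.add_one_pos N)
    omega
  · simp
  · simp

/-- A strand that returns to its starting point bounds a region with at most one corner. -/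
theorem exists_curve_of_walk {d : P.Dart} {N : ℕ}
    (hinj : ∀ i < N + 1, ∀ j < N + 1, (P.straight^[i] d).1 = (P.straight^[j] d).1 → i = j)
    (hN : (P.mate (P.straight^[N] d)).1 = d.1) :
    ∃ c n, P.IsCurve c n ∧
      (∀ i, c (i + 1) = P.turn (P.mate (c i)) 1 ∨ c (i + 1) = P.turn (P.mate (c i)) 2) ∧
      (P.corners c).ncard ≤ 1 ∧
      (∀ i, ∃ j ≤ N, c i = P.straight^[j] d ∨ c i = P.mate (P.straight^[j] d)) ∧
      -- This clause serves to show that a tail which leads into the loop through `turn d 2` arrives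
      -- from outside.
      (P.mate (P.straight^[N] d) ≠ P.turn d 2 →
        ∃ i, c (i + 1) = P.turn (P.mate (c i)) 1 ∧ (c (i + 1)).1 = d.1 ∧
          P.turn d 2 ≠ P.mate (c i)) := by
  have hcard : ∀ (e : P.Dart) (s : Set P.Dart), s ⊆ {e} → s.ncard ≤ 1 := fun e s h => by
    simpa using Set.ncard_le_ncard h
  set m := P.mate (P.straight^[N] d) with hm
  -- The returning half-edge `m` cannot be `d`. If it is `turn d 1`, the strand closes by a left
  -- turn and is reversed; `turn d 2` means closing straight, `turn d 3` closing by a right turn.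
  rcases eq_or_turn hN with h | h | h | h
  · exact absurd h (mate_iterate_ne hinj)
  · have hinj' : ∀ i < N + 1, ∀ j < N + 1,
        (P.straight^[i] m).1 = (P.straight^[j] m).1 → i = j := by
      intro i hi j hj hij
      rw [iterate_reverse_fst d (by omega), iterate_reverse_fst d (by omega)] at hij
      have h0 : (P.straight^[N + 1] d).1 = (P.straight^[0] d).1 := by
        rw [iterate_succ_fst]
        exact hN
      rcases Nat.eq_zero_or_pos i with rfl | hi0 <;> rcases Nat.eq_zero_or_pos j with rfl | hj0
      · rfl
      · rw [Nat.sub_zero, h0] at hij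
        have := hinj _ (by omega) _ (by omega) hij
        omega
      · rw [Nat.sub_zero, h0] at hij
        have := hinj _ (by omega) _ (by omega) hij
        omega
      · have := hinj _ (by omega) _ (by omega) hij
        omega
    have hlast : P.mate (P.straight^[N] m) = d := by
      rw [hm, iterate_reverse d le_rfl, Nat.sub_self, mate_mate]
      rfl
    obtain ⟨c, n, h1, h2, h3, h4, h5, h6⟩ := exists_curve_of_walk_aux hinj'
      (Or.inl (by rw [hlast, h]))
    refine ⟨c, n, h1, h2, hcard _ _ h3, fun i => ?_, fun _ => ⟨N, ?_, ?_, ?_⟩⟩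
    · obtain ⟨j, hj, hj'⟩ := h4 i
      rw [hm, iterate_reverse d hj] at hj'
      exact ⟨N - j, by omega, Or.inr hj'⟩
    · rw [h5, h6, hlast, h]
    · rw [h5, hN]
    · rw [h6, hlast]
      exact turn_ne _ (by norm_num) (by norm_num)
  · obtain ⟨c, n, h1, h2, h3, h4, -⟩ := exists_curve_of_walk_aux hinj
      (Or.inr (by rw [← hm, h, turn_turn, turn_four]))
    refine ⟨c, n, h1, h2, hcard _ _ h3, fun i => ?_, fun h' => absurd h h'⟩
    obtain ⟨j, hj, hj'⟩ := h4 i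
    exact ⟨j, hj, Or.inl hj'⟩
  · obtain ⟨c, n, h1, h2, h3, h4, h5, h6⟩ := exists_curve_of_walk_aux hinj
      (Or.inl (by rw [← hm, h, turn_turn, turn_four]))
    refine ⟨c, n, h1, h2, hcard _ _ h3, fun i => ?_, fun _ => ⟨N, ?_, ?_, ?_⟩⟩
    · obtain ⟨j, hj, hj'⟩ := h4 i
      exact ⟨j, hj, Or.inl hj'⟩
    · rw [h5, h6, ← hm, h, turn_turn, turn_four]
    · rw [h5]
    · rw [h6, ← hm, h, Ne, turn_eq_turn_iff _ (by norm_num) (by norm_num)]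
      omega

/-- There are finitely many crossings, so a strand revisits one, and its part between the two visits
closes up. -/
theorem exists_region (hJ : P.HasSides) (d : P.Dart) :
    ∃ c n S, P.IsRegion c n S ∧ (P.corners c).ncard ≤ 2 := by
  obtain ⟨N, h0, hinj, -, h⟩ := P.exists_walk d ∅
  obtain ⟨-, k, hk, hkN⟩ := h.resolve_left (by simp)
  have hit : ∀ i, P.straight^[i] (P.straight^[k] d) = P.straight^[i + k] d := fun i =>
    (Function.iterate_add_apply _ i k d).symm
  obtain ⟨c, n, hc, ht, hcard, -⟩ := exists_curve_of_walk (d := P.straight^[k] d) (N := N - k - 1)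
    (fun i hi j hj hij => by
      rw [hit, hit] at hij
      have := hinj _ (by omega) _ (by omega) hij
      omega)
    (by rw [hit, ← hkN, ← iterate_succ_fst, show N - k - 1 + k + 1 = N by omega])
  obtain ⟨S, hS⟩ := hJ c n hc
  exact ⟨c, n, S, ⟨hc, hS, ht⟩, by omega⟩

/-- An edge of `c` off `g` has neither side in `T ∩ S`: its left is outside `S` and its right
outside `T`. So only `g` separates the intersection from the rest. -/
theorem IsSide.inter {c g : ℕ → P.Dart} {S T : Set P.Face} (hS : P.IsSide c S) (hT : P.IsSide g T)
    (h1 : ∀ i, P.face (P.mate (g i)) ∈ S)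
    (h2 : ∀ i, ¬ P.OnCurve g (c i) → P.face (P.mate (c i)) ∉ T) : P.IsSide g (T ∩ S) := by
  refine ⟨fun d hd => ?_, fun i h => hT.left i h.1, fun i => ⟨hT.right i, h1 i⟩⟩
  by_cases hdc : P.OnCurve c d
  · obtain ⟨i, rfl | rfl⟩ := hdc
    · exact iff_of_false (fun h => hS.left i h.2) fun h => h2 i hd h.1
    · rw [onCurve_mate] at hd
      rw [mate_mate]
      exact iff_of_false (fun h => h2 i hd h.1) fun h => hS.left i h.2
  · rw [Set.mem_inter_iff, Set.mem_inter_iff, hT.cross d hd, hS.cross d hdc]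

theorem inter_ssubset {S T : Set P.Face} {f : P.Face} (h1 : f ∈ S) (h2 : f ∉ T) : T ∩ S ⊂ S :=
  ⟨Set.inter_subset_right, fun h => h2 (h h1).1⟩

/-! ### Cutting a region along a strand -/

section Cut

variable {c : ℕ → P.Dart} {n : ℕ} {S : Set P.Face} (hR : P.IsRegion c n S)
include hR

/-- At a vertex off `c` all corners are on the same side of `c`, so the strand cannot leave `S`
before it meets `c` again. -/
theorem IsRegion.inner_walk {s N : ℕ} (hs : c (s + 1) = P.turn (P.mate (c s)) 2) {d : P.Dart}
    (hd : d = P.turn (P.mate (c s)) 1)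
    (hoff : ∀ i, 0 < i → i < N → ∀ j, (c j).1 ≠ (P.straight^[i] d).1) :
    ∀ i < N, P.face (P.straight^[i] d) ∈ S ∧ P.face (P.mate (P.straight^[i] d)) ∈ S := by
  intro i
  induction i with
  | zero =>
    intro _
    have h := hR.side.straight_one hR.curve hs
    rw [Function.iterate_zero, id, face_mate, hd, turn_turn, turn_four]
    exact ⟨h, hR.side.right s⟩
  | succ i ih =>
    intro hi
    have h1 := (ih (by omega)).2
    have hc : ∀ e : P.Dart, e.1 = (P.straight^[i + 1] d).1 → P.face e ∈ S := by
      intro e he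
      rw [hR.side.constant hR.curve (d := P.mate (P.straight^[i] d)) _ _]
      · exact h1
      · intro j
        rw [← iterate_succ_fst]
        exact hoff _ (by omega) hi j
      · rw [he, iterate_succ_fst]
    exact ⟨hc _ rfl, by rw [face_mate]; exact hc _ rfl⟩

/-- A strand in a region that crosses itself before it leaves the region cuts off a smaller region
with one corner. -/
theorem IsRegion.exists_loop (hJ : P.HasSides) {s N k : ℕ}
    (hs : c (s + 1) = P.turn (P.mate (c s)) 2) {d : P.Dart} (hd : d = P.turn (P.mate (c s)) 1)
    (hoff : ∀ i, 0 < i → i < N + 1 → ∀ j, (c j).1 ≠ (P.straight^[i] d).1)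
    (hinj : ∀ i < N, ∀ j < N, (P.straight^[i] d).1 = (P.straight^[j] d).1 → i = j)
    (hk : k < N) (hkN : (P.straight^[N] d).1 = (P.straight^[k] d).1) :
    ∃ g n' S', P.IsRegion g n' S' ∧ (P.corners g).ncard ≤ 1 ∧ S' ⊂ S := by
  have hin := hR.inner_walk hs hd (N := N) fun i h0 hi => hoff i h0 (by omega)
  have hd1 : d.1 = (c (s + 1)).1 := by rw [hd, hR.curve.step, turn_fst]
  -- The strand starts on `c` but its double point is off `c`, so a tail of positive length leads to
  -- the loop.
  obtain ⟨k, rfl⟩ : ∃ k', k = k' + 1 := by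
    refine Nat.exists_eq_succ_of_ne_zero ?_
    rintro rfl
    exact hoff N (by omega) (by omega) (s + 1) (by rw [hkN, ← hd1]; rfl)
  set d' := P.straight^[k + 1] d with hd'
  have hit : ∀ i, P.straight^[i] d' = P.straight^[i + (k + 1)] d := fun i =>
    (Function.iterate_add_apply _ i (k + 1) d).symm
  obtain ⟨g, n', hg, ht, hcard, hsub, hcor⟩ := exists_curve_of_walk (d := d') (N := N - (k + 1) - 1)
    (fun i hi j hj hij => by
      rw [hit, hit] at hij
      have := hinj _ (by omega) _ (by omega) hij
      omega)
    (by rw [hit, ← hkN, ← iterate_succ_fst, show N - (k + 1) - 1 + (k + 1) + 1 = N by omega])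
  obtain ⟨T, hT⟩ := hJ g n' hg
  have hgS : ∀ i, P.face (g i) ∈ S ∧ P.face (P.mate (g i)) ∈ S := by
    intro i
    obtain ⟨j, hj, h | h⟩ := hsub i
    · rw [h, hit]
      exact hin _ (by omega)
    · rw [h, hit, mate_mate]
      exact (hin _ (by omega)).symm
  have hgv : ∀ i, ∃ j, k + 1 ≤ j ∧ j < N ∧ (g i).1 = (P.straight^[j] d).1 := by
    intro i
    obtain ⟨j, hj, h | h⟩ := hsub i
    · exact ⟨j + (k + 1), by omega, by omega, by rw [h, hit]⟩
    · rw [hit] at h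
      rcases Nat.lt_or_ge (j + (k + 1) + 1) N with h' | h'
      · exact ⟨_, by omega, h', by rw [h, iterate_succ_fst]⟩
      · refine ⟨k + 1, le_rfl, by omega, ?_⟩
        rw [h, ← iterate_succ_fst, ← hkN, show j + (k + 1) + 1 = N by omega]
  have hgw : ∀ i j, j < k + 1 → (g i).1 ≠ (P.straight^[j] d).1 := by
    intro i j hj h
    obtain ⟨l, h1, h2, h3⟩ := hgv i
    have := hinj l h2 j (by omega) (h3.symm.trans h)
    omega
  have hgc : ∀ i j, (g i).1 ≠ (c j).1 := by
    intro i j h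
    obtain ⟨l, h1, h2, h3⟩ := hgv i
    exact hoff l (by omega) (by omega) j (h.symm.trans h3)
  have hmk : P.mate (P.straight^[k] d) = P.turn d' 2 := by
    rw [hd', Function.iterate_succ_apply', ← mate_eq_turn_straight]
  have hne : P.mate (P.straight^[N - (k + 1) - 1] d') ≠ P.turn d' 2 := by
    rw [← hmk, hit]
    intro h
    have := hinj _ (by omega) _ (by omega) (congrArg Prod.fst (mate_injective h))
    omega
  obtain ⟨i₀, hi1, hi2, hi3⟩ := hcor hne
  -- Of the four corners at the corner vertex of the loop, only the one at the incoming half-edge of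
  -- `g` can belong to `T`, and the tail arrives by a different half-edge.
  have hstart : P.face (P.mate (P.straight^[k] d)) ∉ T := by
    rw [hmk]
    have h3 := hT.turn_mate_three i₀
    have h2 := hT.corner_two hg hi1
    have h1 := hT.left (i₀ + 1)
    rw [hi1] at h1
    rcases eq_or_turn (d := P.mate (g i₀)) (e := P.turn d' 2)
      (by rw [turn_fst, ← hi2, hg.step]) with h | h | h | h
    · exact absurd h hi3
    all_goals rwa [h]
  -- The tail meets the loop only at its end, so all of it lies outside `T`; the same then holds for
  -- `c`, where the tail begins.
  have hback : ∀ j ≤ k, P.face (P.mate (P.straight^[k - j] d)) ∉ T := by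
    intro j
    induction j with
    | zero => exact fun _ => hstart
    | succ j ih =>
      intro hj
      have h1 := ih (by omega)
      rw [← hT.cross] at h1
      · rwa [hT.constant hg (d := P.straight^[k - j] d)]
        · exact fun i => hgw i _ (by omega)
        · rw [← iterate_succ_fst, show k - (j + 1) + 1 = k - j by omega]
      · intro h
        obtain ⟨i, hi⟩ := hg.exists_fst_of_onCurve h
        exact hgw i _ (by omega) hi
  have hcg : ∀ i, ¬ P.OnCurve g (c i) := by
    intro i h
    obtain ⟨j, hj⟩ := hg.exists_fst_of_onCurve h
    exact hgc j i hj
  have hbd : ∀ i, P.face (P.mate (c (s + i))) ∉ T := by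
    intro i
    induction i with
    | zero =>
      have h := hback k le_rfl
      rw [Nat.sub_self] at h
      rw [← hT.cross _ (fun h => ?_)] at h
      · rwa [hT.constant hg (d := d) (fun i => ?_)]
        · rw [hd, add_zero, turn_fst]
        · rw [hd1]
          exact hgc _ _
      · obtain ⟨i, hi⟩ := hg.exists_fst_of_onCurve h
        exact hgw i 0 (by omega) hi
    | succ i ih =>
      rw [← hT.cross _ (hcg _)]
      rwa [hT.constant hg (d := P.mate (c (s + i))) (fun j => ?_)]
      · exact hR.curve.step _
      · rw [← hR.curve.step]
        exact hgc _ _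
  refine ⟨g, n', T ∩ S, ⟨hg, hR.side.inter hT (fun i => (hgS i).2) fun i _ => ?_, ht⟩, hcard,
    inter_ssubset (hgS 0).1 (hT.left 0)⟩
  obtain ⟨j, -, hj, -⟩ := hR.curve.exists_shift s i
  rw [← hj]
  exact hbd j

end Cut

/-! ### Chords of a region -/

/-- The half-edges `d, straight d, …` are the `N` steps of a strand that crosses the region to the
right of the closed curve `c`, from the end of the step `s` of `c` to the end of its step `t`. -/
structure IsChord (P : PDCode) (c : ℕ → P.Dart) (d : P.Dart) (N s t : ℕ) : Prop where
  pos : 0 < N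
  inj : ∀ i < N, ∀ j < N, (P.straight^[i] d).1 = (P.straight^[j] d).1 → i = j
  off : ∀ i, 0 < i → i < N → ∀ j, (c j).1 ≠ (P.straight^[i] d).1
  start : d = P.turn (P.mate (c s)) 1
  finish : P.mate (P.straight^[N - 1] d) = P.turn (P.mate (c t)) 1
  straight_start : c (s + 1) = P.turn (P.mate (c s)) 2
  straight_finish : c (t + 1) = P.turn (P.mate (c t)) 2

namespace IsChord

variable {c : ℕ → P.Dart} {d : P.Dart} {N s t : ℕ}

theorem reverse (h : P.IsChord c d N s t) (hstep : ∀ i, (c (i + 1)).1 = (P.mate (c i)).1) :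
    P.IsChord c (P.mate (P.straight^[N - 1] d)) N t s := by
  have h0 := h.pos
  have hlast : (P.straight^[N] d).1 = (c (t + 1)).1 := by
    rw [show N = N - 1 + 1 by omega, iterate_succ_fst, h.finish, turn_fst, hstep]
  refine ⟨h0, fun i hi j hj hij => ?_, fun i hi0 hi j => ?_, h.finish, ?_, h.straight_finish,
    h.straight_start⟩
  · rw [iterate_reverse_fst d (by omega), iterate_reverse_fst d (by omega)] at hij
    rcases Nat.eq_zero_or_pos i with rfl | hi0 <;> rcases Nat.eq_zero_or_pos j with rfl | hj0
    · rfl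
    · rw [show N - 1 - 0 + 1 = N by omega, hlast] at hij
      exact absurd hij (h.off _ (by omega) (by omega) _)
    · rw [show N - 1 - 0 + 1 = N by omega, hlast] at hij
      exact absurd hij.symm (h.off _ (by omega) (by omega) _)
    · have := h.inj _ (by omega) _ (by omega) hij
      omega
  · rw [iterate_reverse_fst d (by omega)]
    exact h.off _ (by omega) (by omega) _
  · rw [iterate_reverse d le_rfl, Nat.sub_self, mate_mate]
    exact h.start

theorem last_ne (h : P.IsChord c d N s t) : P.mate (P.straight^[N - 1] d) ≠ d := by
  have h0 := h.pos
  refine mate_iterate_ne fun i hi j hj => h.inj i (by omega) j (by omega)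

/-- A chord with coinciding ends would return through the half-edge by which it left. -/
theorem ends_ne (h : P.IsChord c d N s t) : c s ≠ c t := by
  intro h'
  refine h.last_ne ?_
  rw [h.finish, ← h', h.start]

end IsChord

/-- In a region that contains no smaller region with at most one corner, every strand that enters
the region is a chord. -/
theorem IsRegion.exists_chord {c : ℕ → P.Dart} {n : ℕ} {S : Set P.Face} (hR : P.IsRegion c n S)
    (hJ : P.HasSides)
    (hmin : ∀ g n' S', P.IsRegion g n' S' → (P.corners g).ncard ≤ 1 → ¬ S' ⊂ S)
    {s : ℕ} (hs : c (s + 1) = P.turn (P.mate (c s)) 2) :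
    ∃ N t, P.IsChord c (P.turn (P.mate (c s)) 1) N s t := by
  set d := P.turn (P.mate (c s)) 1 with hd
  obtain ⟨N, h0, hinj, hoff, h⟩ := P.exists_walk d (Set.range fun i => (c i).1)
  have hoff' : ∀ i, 0 < i → i < N → ∀ j, (c j).1 ≠ (P.straight^[i] d).1 :=
    fun i h1 h2 j h => hoff i h1 h2 ⟨j, h⟩
  rcases h with ⟨j, hj⟩ | ⟨hN, k, hk, hkN⟩
  · obtain ⟨t, ht⟩ := hR.curve.exists_pred j
    replace hj : (c (t + 1)).1 = (P.straight^[N] d).1 := by rw [ht]; exact hj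
    have hin := hR.inner_walk hs hd hoff' (N - 1) (by omega)
    set m := P.mate (P.straight^[N - 1] d) with hm
    have hmv : m.1 = (P.mate (c t)).1 := by
      rw [hm, ← iterate_succ_fst, show N - 1 + 1 = N by omega, ← hj, hR.curve.step]
    have hmt : P.face (P.turn m 3) ∈ S := by
      rw [hm, face_turn_three_mate]
      exact hin.1
    have h3 := hR.side.turn_mate_three t
    have hl := hR.side.left (t + 1)
    -- The last half-edge `m` has `S` on both sides. No half-edge at a corner of `c` does, and at a
    -- straight vertex only `turn 1` does.
    rcases hR.turns t with ht' | ht'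
    · have h2 := hR.side.corner_two hR.curve ht'
      rw [ht'] at hl
      rcases eq_or_turn hmv with h | h | h | h
      · rw [h] at hmt
        exact absurd hmt h3
      · exact absurd hin.2 (by rwa [h])
      · exact absurd hin.2 (by rwa [h])
      · exact absurd hin.2 (by rwa [h])
    · rw [ht'] at hl
      rcases eq_or_turn hmv with h | h | h | h
      · rw [h] at hmt
        exact absurd hmt h3
      · exact ⟨N, t, h0, hinj, hoff', hd, h, hs, ht'⟩
      · exact absurd hin.2 (by rwa [h])
      · exact absurd hin.2 (by rwa [h])
  · obtain ⟨g, n', S', h1, h2, h3⟩ := hR.exists_loop hJ hs hd (N := N)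
      (fun i h1 h2 j => by
        rcases Nat.lt_or_ge i N with h | h
        · exact hoff' i h1 h j
        · obtain rfl : i = N := by omega
          exact fun h => hN ⟨j, h⟩) hinj hk hkN
    exact absurd h3 (hmin g n' S' h1 h2)

/-- A chord cuts off the part of a region between the chord and the arc from the end of the chord
to its start. -/
theorem IsRegion.exists_cut {c : ℕ → P.Dart} {n : ℕ} {S : Set P.Face} (hR : P.IsRegion c n S)
    (hJ : P.HasSides) {d : P.Dart} {N s t : ℕ} (hch : P.IsChord c d N s t) (hs : s + 1 < n)
    (ht : t + 1 = n) :
    ∃ g n' T, P.IsRegion g n' T ∧ T ⊂ S ∧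
      P.corners g ⊆
        insert d (insert (c 0) {x | ∃ i < s, x = c (i + 1) ∧
          c (i + 1) = P.turn (P.mate (c i)) 1}) ∧
      (∀ y, (∀ j < N, y ≠ P.straight^[j] d ∧ y ≠ P.mate (P.straight^[j] d)) →
        P.face y ∈ S → P.face (P.mate y) ∈ S → (P.face y ∈ T ↔ P.face (P.mate y) ∈ T)) ∧
      (∀ i ≤ s, P.face (P.mate (c i)) ∈ T) ∧
      (∀ i, s < i → i < n → P.face (P.mate (c i)) ∉ T) := by
  have hc := hR.curve
  have h0 := hch.pos
  have hin := hR.inner_walk hch.straight_start hch.start hch.off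
  have hd1 : d.1 = (c (s + 1)).1 := by rw [hch.start, hc.step, turn_fst]
  have hc0 : c 0 = P.turn (P.mate (P.straight^[N - 1] d)) 1 := by
    rw [hch.finish, turn_turn, ← hc.periodic 0, zero_add, ← ht]
    exact hch.straight_finish
  -- The numbering makes the chord end where `c 0` starts, so the new curve consists of `c 0, …, c
  -- s` and the chord. It turns right at both ends of the chord.
  set f : ℕ → P.Dart := fun i => if i ≤ s then c i else P.straight^[i - (s + 1)] d with hf
  have hf1 : ∀ i ≤ s, f i = c i := fun i hi => if_pos hi
  have hf2 : ∀ i, f (i + (s + 1)) = P.straight^[i] d := fun i => by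
    simp only [hf]
    rw [if_neg (by omega), Nat.add_sub_cancel]
  have hcases : ∀ i, i < s + 1 + N → i ≤ s ∨ ∃ j < N, i = j + (s + 1) := by
    intro i hi
    rcases Nat.lt_or_ge s i with h | h
    · exact Or.inr ⟨i - (s + 1), by omega, by omega⟩
    · exact Or.inl h
  have hturn : ∀ i, i + 1 < s + 1 + N →
      (i < s ∧ f i = c i ∧ f (i + 1) = c (i + 1)) ∨
      (f i = c s ∧ f (i + 1) = d ∧ f (i + 1) = P.turn (P.mate (f i)) 1) ∨
      (f (i + 1) = P.turn (P.mate (f i)) 2) := by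
    intro i hi
    rcases hcases i (by omega) with h | ⟨j, hj, rfl⟩
    · rcases Nat.lt_or_ge i s with h' | h'
      · exact Or.inl ⟨h', hf1 i h, hf1 _ h'⟩
      · obtain rfl : i = s := by omega
        have h1 : f (i + 1) = d := by simpa using hf2 0
        exact Or.inr (Or.inl ⟨hf1 i h, h1, by rw [h1, hf1 i h]; exact hch.start⟩)
    · refine Or.inr (Or.inr ?_)
      rw [show j + (s + 1) + 1 = j + 1 + (s + 1) by omega, hf2, hf2, Function.iterate_succ_apply']
      rfl
  have hlast : f (s + 1 + N - 1) = P.straight^[N - 1] d := by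
    rw [show s + 1 + N - 1 = N - 1 + (s + 1) by omega, hf2]
  have hf0 : f 0 = P.turn (P.mate (f (s + 1 + N - 1))) 1 := by
    rw [hlast, hf1 0 (by omega), hc0]
  have hturn' : ∀ i, i + 1 < s + 1 + N →
      f (i + 1) = P.turn (P.mate (f i)) 1 ∨ f (i + 1) = P.turn (P.mate (f i)) 2 := by
    intro i hi
    rcases hturn i hi with ⟨h1, h2, h3⟩ | ⟨-, -, h⟩ | h
    · rw [h2, h3]
      exact hR.turns i
    · exact Or.inl h
    · exact Or.inr h
  have hg : P.IsCurve (fun i => f (i % (s + 1 + N))) (s + 1 + N) := by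
    have hmix : ∀ i ≤ s, ∀ j < N, (c i).1 ≠ (P.straight^[j] d).1 := by
      intro i hi j hj h
      rcases Nat.eq_zero_or_pos j with rfl | hj0
      · rw [Function.iterate_zero, id, hd1] at h
        have := hc.inj _ (by omega) _ (by omega) h
        omega
      · exact hch.off j hj0 hj i h
    refine isCurve_periodize (by omega) (fun i hi => ?_) ⟨?_, ?_⟩ fun i hi j hj hij => ?_
    · rcases hturn' i hi with h | h
      · rw [h]
        exact ⟨rfl, turn_ne _ (by norm_num) (by norm_num)⟩
      · rw [h]
        exact ⟨rfl, turn_ne _ (by norm_num) (by norm_num)⟩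
    · rw [hf0, turn_fst]
    · rw [hf0]
      exact turn_ne _ (by norm_num) (by norm_num)
    · rcases hcases i hi with h1 | ⟨k, hk, rfl⟩ <;> rcases hcases j hj with h2 | ⟨l, hl, rfl⟩
      · rw [hf1 i h1, hf1 j h2] at hij
        exact hc.inj i (by omega) j (by omega) hij
      · rw [hf1 i h1, hf2] at hij
        exact absurd hij (hmix i h1 l hl)
      · rw [hf1 j h2, hf2] at hij
        exact absurd hij.symm (hmix j h2 k hk)
      · rw [hf2, hf2] at hij
        rw [hch.inj k hk l hl hij]
  set g : ℕ → P.Dart := fun i => f (i % (s + 1 + N)) with hgdef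
  have hgf : ∀ i < s + 1 + N, g i = f i := fun i hi => by
    simp only [hgdef]
    rw [Nat.mod_eq_of_lt hi]
  have hgcases : ∀ i, (∃ j ≤ s, g i = c j) ∨ ∃ j < N, g i = P.straight^[j] d := by
    intro i
    rcases hcases (i % (s + 1 + N)) (Nat.mod_lt _ (by omega)) with h | ⟨j, hj, h⟩
    · exact Or.inl ⟨_, h, hf1 _ h⟩
    · refine Or.inr ⟨j, hj, ?_⟩
      simp only [hgdef]
      rw [h, hf2]
  obtain ⟨T, hT⟩ := hJ g _ hg
  have hgc : ∀ i ≤ s, g i = c i := fun i hi => by rw [hgf i (by omega), hf1 i hi]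
  have hgd : ∀ j < N, g (j + (s + 1)) = P.straight^[j] d := fun j hj => by
    rw [hgf _ (by omega), hf2]
  have hin_T : ∀ i ≤ s, P.face (P.mate (c i)) ∈ T := fun i hi => by
    rw [← hgc i hi]
    exact hT.right i
  -- Behind the start of the chord, `c` continues on the left of the new curve and does not meet it
  -- before closing up, so it stays outside `T`.
  have hout_T : ∀ i, s + 1 + i < n → P.face (P.mate (c (s + 1 + i))) ∉ T := by
    intro i
    induction i with
    | zero =>
      intro _
      rw [add_zero, face_mate, hch.straight_start, turn_turn, turn_five, ← hch.start]
      have := hT.left (0 + (s + 1))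
      rwa [hgd 0 h0] at this
    | succ i ih =>
      intro hi
      have hoff : ∀ j, (g j).1 ≠ (c (s + 1 + i + 1)).1 := by
        intro j hj
        rcases hgcases j with ⟨l, hl, h⟩ | ⟨l, hl, h⟩
        · rw [h] at hj
          have := hc.inj _ (by omega) _ (by omega) hj
          omega
        · rw [h] at hj
          rcases Nat.eq_zero_or_pos l with rfl | hl0
          · rw [Function.iterate_zero, id, hd1] at hj
            have := hc.inj _ (by omega) _ (by omega) hj
            omega
          · exact hch.off l hl0 hl _ hj.symm
      rw [← add_assoc, face_mate, hT.constant hg (d := P.mate (c (s + 1 + i))) (fun j => ?_)]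
      · exact ih (by omega)
      · rw [turn_fst, hc.step]
      · rw [← hc.step]
        exact hoff j
  have hgS : ∀ i, P.face (P.mate (g i)) ∈ S := by
    intro i
    rcases hgcases i with ⟨j, -, h⟩ | ⟨j, hj, h⟩
    · rw [h]
      exact hR.side.right j
    · rw [h]
      exact (hin j hj).2
  have hout' : ∀ i, s < i → i < n → P.face (P.mate (c i)) ∉ T := fun i h1 h2 => by
    have := hout_T (i - (s + 1)) (by omega)
    rwa [show s + 1 + (i - (s + 1)) = i by omega] at this
  refine ⟨g, s + 1 + N, T ∩ S, ⟨hg, hR.side.inter hT hgS fun i hi => ?_, fun i => ?_⟩,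
    inter_ssubset (f := P.face d) (hin 0 h0).1 (by
      have := hT.left (0 + (s + 1))
      rwa [hgd 0 h0] at this), ?_, fun y hy h1 h2 => ?_,
    fun i hi => ⟨hin_T i hi, hR.side.right i⟩, fun i h1 h2 h => hout' i h1 h2 h.1⟩
  · rw [← hc.apply_mod] at hi ⊢
    refine hout' _ ?_ (hc.mod_lt i)
    by_contra hle
    exact hi ⟨i % n, Or.inl (hgc _ (by omega)).symm⟩
  · simp only [hgdef]
    rcases mod_succ_cases (show 0 < s + 1 + N by omega) i with ⟨h1, h2⟩ | ⟨h1, h2⟩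
    · rw [h1]
      exact hturn' _ h2
    · rw [h1, h2]
      exact Or.inl hf0
  · rintro x ⟨i, rfl, hx⟩
    simp only [hgdef] at hx ⊢
    rcases mod_succ_cases (show 0 < s + 1 + N by omega) i with ⟨h1, h2⟩ | ⟨h1, h2⟩
    · rw [h1] at hx ⊢
      rcases hturn _ h2 with ⟨h3, h4, h5⟩ | ⟨-, h4, -⟩ | h4
      · rw [h4, h5] at hx
        rw [h5]
        exact Or.inr (Or.inr ⟨_, h3, rfl, hx⟩)
      · exact Or.inl h4
      · exact absurd hx (not_corner_of_straight (c := f) h4)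
    · rw [h1, hf1 0 (by omega)]
      exact Or.inr (Or.inl rfl)
  · have hyc : P.OnCurve g y → False := by
      rintro ⟨i, hi⟩
      rcases hgcases i with ⟨j, hj, h⟩ | ⟨j, hj, h⟩
      · rw [h] at hi
        rcases hi with rfl | rfl
        · exact hR.side.left j h1
        · rw [mate_mate] at h2
          exact hR.side.left j h2
      · rw [h] at hi
        rcases hi with hi | hi
        · exact (hy j hj).1 hi
        · exact (hy j hj).2 hi
    rw [Set.mem_inter_iff, Set.mem_inter_iff, hT.cross y hyc]
    tauto

/-! ### Minimal regions -/

/-- A region with at most two corners that contains no smaller such region. -/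
structure IsMinimalRegion (P : PDCode) (c : ℕ → P.Dart) (n : ℕ) (S : Set P.Face) : Prop where
  region : P.IsRegion c n S
  corners_le : (P.corners c).ncard ≤ 2
  minimal : ∀ g n' S', P.IsRegion g n' S' → (P.corners g).ncard ≤ 2 → ¬ S' ⊂ S

theorem exists_isMinimalRegion (hJ : P.HasSides) (d : P.Dart) :
    ∃ c n S, P.IsMinimalRegion c n S := by
  have hwf : WellFounded fun S S' : Set P.Face => S ⊂ S' := wellFounded_lt
  obtain ⟨c, n, S, h⟩ := exists_region hJ d
  obtain ⟨S, ⟨c, n, h1, h2⟩, hmin⟩ := hwf.has_min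
    {S | ∃ c n, P.IsRegion c n S ∧ (P.corners c).ncard ≤ 2} ⟨S, c, n, h⟩
  exact ⟨c, n, S, h1, h2, fun g n' S' h1 h2 => hmin S' ⟨g, n', h1, h2⟩⟩

theorem IsMinimalRegion.shift {c : ℕ → P.Dart} {n : ℕ} {S : Set P.Face}
    (hM : P.IsMinimalRegion c n S) (k : ℕ) : P.IsMinimalRegion (fun i => c (k + i)) n S :=
  ⟨hM.region.shift k, by rw [hM.region.curve.corners_shift]; exact hM.corners_le, hM.minimal⟩

theorem IsChord.shift {c : ℕ → P.Dart} {n : ℕ} (hc : P.IsCurve c n) {d : P.Dart} {N s t : ℕ}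
    (h : P.IsChord c d N s t) {k s' t' : ℕ} (hs : c (k + s') = c s) (ht : c (k + t') = c t) :
    P.IsChord (fun i => c (k + i)) d N s' t' := by
  have hs' := hc.succ_eq hs
  have ht' := hc.succ_eq ht
  refine ⟨h.pos, h.inj, fun i h1 h2 j => h.off i h1 h2 _, ?_, ?_, ?_, ?_⟩
  · rw [hs]; exact h.start
  · rw [ht]; exact h.finish
  · change c (k + s' + 1) = _
    rw [hs, hs']; exact h.straight_start
  · change c (k + t' + 1) = _
    rw [ht, ht']; exact h.straight_finish

theorem IsChord.exists_shift {c : ℕ → P.Dart} {n : ℕ} (hc : P.IsCurve c n) {d : P.Dart}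
    {N s t : ℕ} (h : P.IsChord c d N s t) :
    ∃ k s', s' + 1 < n ∧ P.IsChord (fun i => c (k + i)) d N s' (n - 1) := by
  have hn := hc.pos
  obtain ⟨s', hs', hs, -⟩ := hc.exists_shift (t + 1) s
  have ht : c (t + 1 + (n - 1)) = c t := by
    rw [show t + 1 + (n - 1) = t + n by omega, hc.periodic]
  have hch := h.shift hc hs ht
  refine ⟨t + 1, s', ?_, hch⟩
  by_contra hle
  refine hch.ends_ne ?_
  simp only [show s' = n - 1 by omega]

/-- Otherwise the part cut off has no corners but the two ends of the chord, which contradicts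
minimality. -/
theorem IsMinimalRegion.exists_corner_on_arc {c : ℕ → P.Dart} {n : ℕ} {S : Set P.Face}
    (hM : P.IsMinimalRegion c n S) (hJ : P.HasSides) {d : P.Dart} {N s t : ℕ}
    (hch : P.IsChord c d N s t) (hs : s + 1 < n) (ht : t + 1 = n) :
    ∃ i < s, c (i + 1) = P.turn (P.mate (c i)) 1 := by
  obtain ⟨g, n', T, hT, hTS, hcor, -⟩ := hM.region.exists_cut hJ hch hs ht
  by_contra hno
  push Not at hno
  refine hM.minimal g n' T hT ?_ hTS
  refine (Set.ncard_le_ncard (t := {d, c 0}) (fun x hx => ?_)).trans 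
    ((Set.ncard_insert_le _ _).trans (by rw [Set.ncard_singleton]))
  rcases hcor hx with h | h | ⟨i, hi, -, h⟩
  · exact Or.inl h
  · exact Or.inr h
  · exact absurd h (hno i hi)

/-- In a minimal region, each chord separates the corners. -/
theorem IsMinimalRegion.exists_corners {c : ℕ → P.Dart} {n : ℕ} {S : Set P.Face}
    (hM : P.IsMinimalRegion c n S) (hJ : P.HasSides) {d : P.Dart} {N s t : ℕ}
    (hch : P.IsChord c d N s t) (hs : s + 1 < n) (ht : t + 1 = n) :
    (∃ i < s, c (i + 1) = P.turn (P.mate (c i)) 1) ∧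
      ∃ i, s < i ∧ i + 1 < n ∧ c (i + 1) = P.turn (P.mate (c i)) 1 := by
  have hc := hM.region.curve
  refine ⟨hM.exists_corner_on_arc hJ hch hs ht, ?_⟩
  -- Reversing the chord and starting the numbering at `s + 1` puts the other arc in the place of
  -- the first.
  have hch' := (hch.reverse hc.step).shift hc (k := s + 1) (s' := n - 2 - s) (t' := n - 1)
    (by congr 1; omega) (by rw [show s + 1 + (n - 1) = s + n by omega, hc.periodic])
  obtain ⟨i, hi, h⟩ := (hM.shift (s + 1)).exists_corner_on_arc hJ hch' (by omega) (by omega)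
  exact ⟨s + 1 + i, by omega, by omega, h⟩

theorem IsMinimalRegion.exists_chord {c : ℕ → P.Dart} {n : ℕ} {S : Set P.Face}
    (hM : P.IsMinimalRegion c n S) (hJ : P.HasSides) {s : ℕ}
    (hs : c (s + 1) = P.turn (P.mate (c s)) 2) :
    ∃ N t, P.IsChord c (P.turn (P.mate (c s)) 1) N s t :=
  hM.region.exists_chord hJ (fun g n' S' h1 h2 => hM.minimal g n' S' h1 (by omega)) hs

/-- A straight vertex gives a chord, which separates two corners. Without straight vertices a single
corner would mean that `c` is a kink, whose crossing has two opposite corners in one face. -/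
theorem IsMinimalRegion.ncard_corners {c : ℕ → P.Dart} {n : ℕ} {S : Set P.Face}
    (hM : P.IsMinimalRegion c n S) (hJ : P.HasSides)
    (hred : ∀ d : P.Dart, P.face d ≠ P.face (P.turn d 2)) : (P.corners c).ncard = 2 := by
  have hc := hM.region.curve
  have hn := hc.pos
  refine le_antisymm hM.corners_le ?_
  suffices h : 1 < (P.corners c).ncard by omega
  rw [Set.one_lt_ncard_iff]
  by_cases h : ∃ s, c (s + 1) = P.turn (P.mate (c s)) 2
  · obtain ⟨s, hs⟩ := h
    obtain ⟨N, t, hch⟩ := hM.exists_chord hJ hs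
    obtain ⟨k, s', hs', hch'⟩ := hch.exists_shift hc
    obtain ⟨⟨i, hi, h1⟩, j, hj, hj', h2⟩ := (hM.shift k).exists_corners hJ hch' hs' (by omega)
    refine ⟨c (k + (i + 1)), c (k + (j + 1)), ⟨k + i, rfl, h1⟩, ⟨k + j, rfl, h2⟩, fun h => ?_⟩
    have := (hc.shift k).inj (i + 1) (by omega) (j + 1) (by omega) (congrArg Prod.fst h)
    omega
  · have hcor : ∀ i, c (i + 1) = P.turn (P.mate (c i)) 1 := fun i =>
      (hM.region.turns i).resolve_right fun h' => h ⟨i, h'⟩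
    refine ⟨c 1, c 2, ⟨0, rfl, hcor 0⟩, ⟨1, rfl, hcor 1⟩, fun h12 => ?_⟩
    have h1 := hcor 1
    change c 2 = _ at h1
    rw [← h12] at h1
    refine hred (P.turn (P.mate (c 1)) 1) ?_
    rw [turn_turn, face_turn_three_mate, ← h1]

/-! ### The subgraph in a region -/

/-- The half-edges of the edges that border a face in `S`. -/
def borderDarts (P : PDCode) (S : Set P.Face) : Set P.Dart :=
  {d | P.face d ∈ S ∨ P.face (P.mate d) ∈ S}

theorem mem_borderDarts {S : Set P.Face} {d : P.Dart} :
    d ∈ P.borderDarts S ↔ P.face d ∈ S ∨ P.face (P.turn d 3) ∈ S := by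
  rw [← face_mate]
  rfl

theorem mate_mem_borderDarts {S : Set P.Face} {d : P.Dart} (h : d ∈ P.borderDarts S) :
    P.mate d ∈ P.borderDarts S := by
  rcases h with h | h
  · exact Or.inr (by rwa [mate_mate])
  · exact Or.inl h

open Classical in
theorem degree_eq (H : Set P.Dart) (d : P.Dart) :
    P.degree H d.1 = (if d ∈ H then 1 else 0) + (if P.turn d 1 ∈ H then 1 else 0) +
      (if P.turn d 2 ∈ H then 1 else 0) + (if P.turn d 3 ∈ H then 1 else 0) := by
  have h1 : P.degree H d.1 = ∑ i : ZMod 4, if (d.1, i) ∈ H then 1 else 0 := by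
    rw [degree, Set.ncard_eq_toFinset_card', Finset.sum_boole]
    simp
  have h2 : ∑ i : ZMod 4, (if (d.1, d.2 + i) ∈ H then 1 else 0) =
      ∑ i : ZMod 4, if (d.1, i) ∈ H then 1 else 0 :=
    Equiv.sum_comp (Equiv.addLeft d.2) (fun i => if (d.1, i) ∈ H then 1 else 0)
  rw [h1, ← h2]
  change ∑ i : Fin 4, _ = _
  rw [Fin.sum_univ_four]
  have h0 : P.turn d 0 = d := turn_zero d
  exact congrArg (fun x => (if x ∈ H then 1 else 0) + (if P.turn d 1 ∈ H then 1 else 0) +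
    (if P.turn d 2 ∈ H then 1 else 0) + (if P.turn d 3 ∈ H then 1 else 0)) h0

theorem Follows.unique {H : Set P.Dart} {a b m : P.Dart} (ha : a ∈ H) (hb : b ∈ H)
    (ham : P.Follows H a m) (hbm : P.Follows H b m) : a = b := by
  have key : ∀ a b : P.Dart, ∀ k l : ℕ, k < l → l ≤ 3 → a ∈ H → P.Clear H b l →
      m = P.turn a (k + 1) → m = P.turn b (l + 1) → False := by
    intro a b k l hkl hl ha hcl h1 h2
    have h3 : a = P.turn b (l - k) := by
      rw [← turn_add_four, show l - k + 4 = l + 1 + (3 - k) by omega, ← turn_turn, ← h2, h1,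
        turn_turn, show k + 1 + (3 - k) = 4 by omega, turn_four]
    exact hcl (l - k) (by omega) (by omega) (h3 ▸ ha)
  obtain ⟨-, k, hk, hck, h1⟩ := ham
  obtain ⟨-, l, hl, hcl, h2⟩ := hbm
  rcases lt_trichotomy k l with h | rfl | h
  · exact (key a b k l h hl ha hcl h1 h2).elim
  · have h3 : P.turn (P.turn a (k + 1)) (3 - k) = P.turn (P.turn b (k + 1)) (3 - k) := by
      rw [← h1, ← h2]
    rwa [turn_turn, turn_turn, show k + 1 + (3 - k) = 4 by omega, turn_four, turn_four] at h3
  · exact (key b a l k h hk hb hck h2 h1).elim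

theorem Follows.one {H : Set P.Dart} {m : P.Dart} (hm : m ∈ H) (h2 : P.turn m 2 ∉ H)
    (h3 : P.turn m 3 ∉ H) : P.Follows H (P.turn m 1) m := by
  refine ⟨hm, 2, by norm_num, fun k h1 h2 => ?_, by rw [turn_turn, turn_four]⟩
  interval_cases k <;> rwa [turn_turn]

theorem Follows.two {H : Set P.Dart} {m : P.Dart} (hm : m ∈ H) (h3 : P.turn m 3 ∉ H) :
    P.Follows H (P.turn m 2) m := by
  refine ⟨hm, 1, by norm_num, fun k h1 h2 => ?_, by rw [turn_turn, turn_four]⟩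
  interval_cases k
  rwa [turn_turn]

section Region

variable {c : ℕ → P.Dart} {n : ℕ} {S : Set P.Face} (hR : P.IsRegion c n S)
include hR

namespace IsRegion

theorem mem_border (i : ℕ) : c i ∈ P.borderDarts S := Or.inr (hR.side.right i)

theorem corner_border {i : ℕ} (h : c (i + 1) = P.turn (P.mate (c i)) 1) :
    P.mate (c i) ∈ P.borderDarts S ∧ P.turn (P.mate (c i)) 1 ∈ P.borderDarts S ∧
      P.turn (P.mate (c i)) 2 ∉ P.borderDarts S ∧ P.turn (P.mate (c i)) 3 ∉ P.borderDarts S := by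
  have h2 := hR.side.corner_two hR.curve h
  have h3 := hR.side.turn_mate_three i
  have h1 := hR.side.left (i + 1)
  rw [h] at h1
  refine ⟨mate_mem_borderDarts (hR.mem_border i), h ▸ hR.mem_border (i + 1), ?_, ?_⟩
  · rw [mem_borderDarts, turn_turn, turn_five]
    tauto
  · rw [mem_borderDarts, turn_turn, turn_six]
    tauto

theorem straight_border {i : ℕ} (h : c (i + 1) = P.turn (P.mate (c i)) 2) :
    P.mate (c i) ∈ P.borderDarts S ∧ P.turn (P.mate (c i)) 1 ∈ P.borderDarts S ∧
      P.turn (P.mate (c i)) 2 ∈ P.borderDarts S ∧ P.turn (P.mate (c i)) 3 ∉ P.borderDarts S := by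
  have h1 := hR.side.straight_one hR.curve h
  have h3 := hR.side.turn_mate_three i
  have h2 := hR.side.left (i + 1)
  rw [h] at h2
  refine ⟨mate_mem_borderDarts (hR.mem_border i), Or.inl h1, h ▸ hR.mem_border (i + 1), ?_⟩
  rw [mem_borderDarts, turn_turn, turn_six]
  tauto

theorem face_mem_of_off {d e : P.Dart} (hd : d ∈ P.borderDarts S) (hoff : ∀ i, (c i).1 ≠ d.1)
    (he : e.1 = d.1) : P.face e ∈ S := by
  rw [hR.side.constant hR.curve hoff he]
  rcases mem_borderDarts.1 hd with h | h
  · exact h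
  · rwa [hR.side.constant hR.curve hoff (turn_fst d 3)] at h

/-- On a path to `c 0` in the whole graph, every vertex reached before `c` has all its edges in the
border graph, so the path stays in that graph until it meets `c`. -/
theorem connected_to (hl : P.Linked) {d : P.Dart} (hd : d ∈ P.borderDarts S) :
    ∃ i, Relation.ReflTransGen (fun a b => a ∈ P.borderDarts S ∧ b ∈ P.borderDarts S ∧
      (b = P.mate a ∨ b.1 = a.1)) d (c i) := by
  suffices H : ∀ u v : P.X, Relation.ReflTransGen
      (fun a b => ∃ d : P.Dart, d.1 = a ∧ (P.mate d).1 = b) u v → v = (c 0).1 →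
      ∀ d ∈ P.borderDarts S, d.1 = u →
      ∃ i, Relation.ReflTransGen (fun a b => a ∈ P.borderDarts S ∧ b ∈ P.borderDarts S ∧
        (b = P.mate a ∨ b.1 = a.1)) d (c i) from
    H _ _ (hl d.1 (c 0).1) rfl d hd rfl
  rintro u v h rfl
  have hon : ∀ d ∈ P.borderDarts S, ∀ i, (c i).1 = d.1 →
      ∃ i, Relation.ReflTransGen (fun a b => a ∈ P.borderDarts S ∧ b ∈ P.borderDarts S ∧
        (b = P.mate a ∨ b.1 = a.1)) d (c i) := fun d hd i hi =>
    ⟨i, Relation.ReflTransGen.single ⟨hd, hR.mem_border i, Or.inr hi⟩⟩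
  induction h using Relation.ReflTransGen.head_induction_on with
  | refl => exact fun d hd h => hon d hd 0 h.symm
  | head h _ ih =>
    rintro d hd rfl
    obtain ⟨e, he1, rfl⟩ := h
    by_cases hex : ∃ i, (c i).1 = d.1
    · obtain ⟨i, hi⟩ := hex
      exact hon d hd i hi
    · push Not at hex
      have he : e ∈ P.borderDarts S := Or.inl (hR.face_mem_of_off hd hex he1)
      have he' := mate_mem_borderDarts he
      obtain ⟨i, hi⟩ := ih _ he' rfl
      exact ⟨i, (hi.head ⟨he, he', Or.inl rfl⟩).head ⟨hd, he, Or.inr he1⟩⟩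

theorem connected_curve (i : ℕ) :
    Relation.ReflTransGen (fun a b => a ∈ P.borderDarts S ∧ b ∈ P.borderDarts S ∧
      (b = P.mate a ∨ b.1 = a.1)) (c 0) (c i) := by
  induction i with
  | zero => exact Relation.ReflTransGen.refl
  | succ i ih =>
    have h1 := hR.mem_border i
    have h2 := mate_mem_borderDarts h1
    exact (ih.tail ⟨h1, h2, Or.inl rfl⟩).tail ⟨h2, hR.mem_border (i + 1), Or.inr (hR.curve.step i)⟩

theorem connected (hl : P.Linked) {d e : P.Dart} (hd : d ∈ P.borderDarts S)
    (he : e ∈ P.borderDarts S) :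
    Relation.ReflTransGen (fun a b => a ∈ P.borderDarts S ∧ b ∈ P.borderDarts S ∧
      (b = P.mate a ∨ b.1 = a.1)) d e := by
  have hr : Std.Symm fun a b : P.Dart =>
      a ∈ P.borderDarts S ∧ b ∈ P.borderDarts S ∧ (b = P.mate a ∨ b.1 = a.1) :=
    ⟨fun a b ⟨h1, h2, h3⟩ => ⟨h2, h1, h3.imp (fun h => by rw [h, mate_mate]) Eq.symm⟩⟩
  have hsymm := (Relation.ReflTransGen.stdSymm (r := fun a b : P.Dart =>
      a ∈ P.borderDarts S ∧ b ∈ P.borderDarts S ∧ (b = P.mate a ∨ b.1 = a.1))).symm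
  obtain ⟨i, hi⟩ := hR.connected_to hl hd
  obtain ⟨j, hj⟩ := hR.connected_to hl he
  exact ((hi.trans (hsymm _ _ (hR.connected_curve i))).trans (hR.connected_curve j)).trans
    (hsymm _ _ hj)

/-- At each vertex of `c`, the half-edges that border `S` form a counterclockwise run from `mate (c
i)` to `c (i + 1)`. So `mate (c i)` is the next one after `c (i + 1)`, which is the rule for walking
around a face. -/
theorem isFaceOf : P.IsFaceOf (P.borderDarts S) (Set.range c) := by
  have hfol : ∀ i, P.Follows (P.borderDarts S) (c (i + 1)) (P.mate (c i)) := by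
    intro i
    rcases hR.turns i with h | h
    · obtain ⟨h0, -, h2, h3⟩ := hR.corner_border h
      rw [h]
      exact Follows.one h0 h2 h3
    · obtain ⟨h0, -, -, h3⟩ := hR.straight_border h
      rw [h]
      exact Follows.two h0 h3
  refine ⟨c 0, hR.mem_border 0, Set.Subset.antisymm ?_ fun e he => ?_⟩
  · rintro _ ⟨i, rfl⟩
    induction i with
    | zero => exact Relation.ReflTransGen.refl
    | succ i ih => exact Relation.ReflTransGen.tail ih ⟨hR.mem_border _, hfol i⟩
  · induction he with
    | refl => exact ⟨0, rfl⟩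
    | tail _ h ih =>
      obtain ⟨i, rfl⟩ := ih
      exact ⟨i + 1, (hfol i).unique (hR.mem_border _) h.1 h.2⟩

theorem degree_corner {i : ℕ} (h : c (i + 1) = P.turn (P.mate (c i)) 1) :
    P.degree (P.borderDarts S) (c (i + 1)).1 = 2 := by
  obtain ⟨h0, h1, h2, h3⟩ := hR.corner_border h
  rw [hR.curve.step, degree_eq, if_pos h0, if_pos h1, if_neg h2, if_neg h3]

theorem degree_straight {i : ℕ} (h : c (i + 1) = P.turn (P.mate (c i)) 2) :
    P.degree (P.borderDarts S) (c (i + 1)).1 = 3 := by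
  obtain ⟨h0, h1, h2, h3⟩ := hR.straight_border h
  rw [hR.curve.step, degree_eq, if_pos h0, if_pos h1, if_pos h2, if_neg h3]

theorem degree_off {d : P.Dart} (hd : d ∈ P.borderDarts S) (hoff : ∀ i, (c i).1 ≠ d.1) :
    P.degree (P.borderDarts S) d.1 = 4 := by
  have h : ∀ e : P.Dart, e.1 = d.1 → e ∈ P.borderDarts S := fun e he =>
    Or.inl (hR.face_mem_of_off hd hoff he)
  rw [degree_eq, if_pos hd, if_pos (h (P.turn d 1) rfl), if_pos (h (P.turn d 2) rfl),
    if_pos (h (P.turn d 3) rfl)]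

theorem inSector (i : ℕ) {e : P.Dart} (he : e.1 = (c (i + 1)).1) (heH : e ∉ P.borderDarts S) :
    P.InSector (P.borderDarts S) (c (i + 1)) e := by
  rcases hR.turns i with h | h
  · obtain ⟨h0, h1, h2, h3⟩ := hR.corner_border h
    rw [hR.curve.step] at he
    rcases eq_or_turn he with rfl | rfl | rfl | rfl
    · exact absurd h0 heH
    · exact absurd h1 heH
    · refine ⟨1, le_rfl, by norm_num, fun k h1 h2 => ?_, by rw [h, turn_turn]⟩
      interval_cases k
      rwa [h, turn_turn]
    · refine ⟨2, by norm_num, by norm_num, fun k h1 h2 => ?_, by rw [h, turn_turn]⟩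
      interval_cases k <;> rwa [h, turn_turn]
  · obtain ⟨h0, h1, h2, h3⟩ := hR.straight_border h
    rw [hR.curve.step] at he
    rcases eq_or_turn he with rfl | rfl | rfl | rfl
    · exact absurd h0 heH
    · exact absurd h1 heH
    · exact absurd h2 heH
    · refine ⟨1, le_rfl, by norm_num, fun k h1 h2 => ?_, by rw [h, turn_turn]⟩
      interval_cases k
      rwa [h, turn_turn]

theorem isTwoRegionOf (hl : P.Linked) (h2 : (P.corners c).ncard = 2) :
    P.IsTwoRegionOf Set.univ (P.borderDarts S) := by
  refine ⟨fun d => mate_mem_borderDarts, Set.subset_univ _,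
    fun d hd e he => Relation.ReflTransGen.mono (fun _ _ h => h.2) _ _ (hR.connected hl hd he),
    Set.range c, hR.isFaceOf, ?_, ?_, ?_, ?_, ?_⟩
  · rintro _ ⟨i, rfl⟩ _ ⟨j, rfl⟩ h
    exact hR.curve.eq_of_fst h
  · convert h2 using 2
    ext d
    constructor
    · rintro ⟨⟨i, rfl⟩, hd⟩
      obtain ⟨j, hj⟩ := hR.curve.exists_pred i
      rw [← hj] at hd ⊢
      refine ⟨j, rfl, (hR.turns j).resolve_right fun h => ?_⟩
      rw [hR.degree_straight h] at hd
      omega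
    · rintro ⟨i, rfl, h⟩
      exact ⟨⟨i + 1, rfl⟩, hR.degree_corner h⟩
  · rintro _ ⟨i, rfl⟩
    obtain ⟨j, hj⟩ := hR.curve.exists_pred i
    rw [← hj]
    exact (hR.turns j).imp hR.degree_corner hR.degree_straight
  · refine fun d hd h => hR.degree_off hd fun i hi => h ⟨c i, ⟨i, rfl⟩, hi⟩
  · rintro _ ⟨i, rfl⟩ e - he heH
    obtain ⟨j, hj⟩ := hR.curve.exists_pred i
    rw [← hj] at he ⊢
    exact hR.inSector j he heH

end IsRegion

end Region

/-! ### The boundary walk of a face as a closed curve -/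

/-- If `m` is the only half-edge of `H` at its vertex, it follows itself after a full turn, with `k
= 3`. -/
theorem exists_follows {H : Set P.Dart} {m : P.Dart} (hm : m ∈ H) :
    ∃ b ∈ H, P.Follows H b m := by
  by_cases h3 : P.turn m 3 ∈ H
  · refine ⟨_, h3, hm, 0, by norm_num, fun k h1 h2 => by omega, ?_⟩
    rw [turn_turn, turn_four]
  by_cases h2 : P.turn m 2 ∈ H
  · exact ⟨_, h2, Follows.two hm h3⟩
  by_cases h1 : P.turn m 1 ∈ H
  · exact ⟨_, h1, Follows.one hm h2 h3⟩
  refine ⟨m, hm, hm, 3, le_rfl, fun k h4 h5 => ?_, by rw [turn_four]⟩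
  interval_cases k <;> assumption

theorem Follows.unique_right {H : Set P.Dart} {b m m' : P.Dart} (h : P.Follows H b m)
    (h' : P.Follows H b m') : m = m' := by
  obtain ⟨hm, k, hk, hck, rfl⟩ := h
  obtain ⟨hm', l, hl, hcl, rfl⟩ := h'
  rcases lt_trichotomy k l with h | rfl | h
  · exact absurd hm (hcl _ (by omega) (by omega))
  · rfl
  · exact absurd hm' (hck _ (by omega) (by omega))

/-- The face walk iterates an injective map of the finite set `H`, so it is periodic. Injectivity on
vertices makes it simple over one minimal period, and turning back would need a vertex of degree 1.
-/
theorem exists_curve_of_isFaceOf {H F : Set P.Dart} (hH : P.IsSubgraph H) (hF : P.IsFaceOf H F)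
    (hinj : Set.InjOn Prod.fst F) (hdeg : ∀ d ∈ F, P.degree H d.1 = 2 ∨ P.degree H d.1 = 3) :
    ∃ c n, P.IsCurve c n ∧ Set.range c = F ∧ (∀ i, c i ∈ H) ∧
      ∀ i, P.Follows H (c (i + 1)) (P.mate (c i)) := by
  choose f hf1 hf2 using fun d : H => exists_follows (hH d.1 d.2)
  let φ : H → H := fun d => ⟨f d, hf1 d⟩
  have hφ : Function.Injective φ := by
    intro a b hab
    have h1 := hf2 a
    rw [show f a = f b from congrArg Subtype.val hab] at h1
    exact Subtype.ext (mate_injective (h1.unique_right (hf2 b)))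
  obtain ⟨d, hd, rfl⟩ := hF
  let d₀ : H := ⟨d, hd⟩
  have hper : d₀ ∈ Function.periodicPts φ := hφ.mem_periodicPts d₀
  have hfol : ∀ i, P.Follows H (φ^[i + 1] d₀).1 (P.mate (φ^[i] d₀).1) := by
    intro i
    rw [Function.iterate_succ_apply']
    exact hf2 _
  have hrange : Set.range (fun i => (φ^[i] d₀).1) =
      {e | Relation.ReflTransGen (fun a b => b ∈ H ∧ P.Follows H b (P.mate a)) d e} := by
    refine Set.Subset.antisymm ?_ fun e he => ?_
    · rintro _ ⟨i, rfl⟩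
      induction i with
      | zero => exact Relation.ReflTransGen.refl
      | succ i ih => exact Relation.ReflTransGen.tail ih ⟨(φ^[i + 1] d₀).2, hfol i⟩
    · induction he with
      | refl => exact ⟨0, rfl⟩
      | tail _ h ih =>
        obtain ⟨i, rfl⟩ := ih
        exact ⟨i + 1, (hfol i).unique (φ^[i + 1] d₀).2 h.1 h.2⟩
  rw [← hrange] at hinj hdeg
  refine ⟨fun i => (φ^[i] d₀).1, Function.minimalPeriod φ d₀,
    ⟨Function.minimalPeriod_pos_of_mem_periodicPts hper, fun i => ?_, fun i => ?_,
      fun i hi j hj hij => ?_, fun i h => ?_⟩, hrange, fun i => (φ^[i] d₀).2, hfol⟩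
  · simp only [Function.iterate_add_apply, Function.iterate_minimalPeriod]
  · obtain ⟨-, k, -, -, h⟩ := hfol i
    rw [h, turn_fst]
  · have h := hinj ⟨i, rfl⟩ ⟨j, rfl⟩ hij
    exact Function.iterate_injOn_Iio_minimalPeriod hi hj (Subtype.ext h)
  · obtain ⟨-, k, hk, hcl, hk'⟩ := hfol i
    have hk3 : k = 3 := by
      by_contra hne
      rw [← h] at hk'
      exact turn_ne _ (by omega) (by omega) hk'.symm
    subst hk3
    have hd := hdeg _ ⟨i + 1, rfl⟩
    simp only at hd
    rw [degree_eq, if_pos (φ^[i + 1] d₀).2, if_neg (hcl 1 (by norm_num) (by norm_num)),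
      if_neg (hcl 2 (by norm_num) (by norm_num)), if_neg (hcl 3 (by norm_num) (by norm_num))] at hd
    omega

/-- The 2-region `K` of the graph `H` is bounded by the closed curve `g`. -/
structure IsBoundedBy (P : PDCode) (H K : Set P.Dart) (g : ℕ → P.Dart) (n : ℕ) : Prop where
  curve : P.IsCurve g n
  mate_mem : ∀ d ∈ K, P.mate d ∈ K
  subset : K ⊆ H
  mem : ∀ i, g i ∈ K
  follows : ∀ i, P.Follows K (g (i + 1)) (P.mate (g i))
  degree_on : ∀ i, P.degree K (g i).1 = 2 ∨ P.degree K (g i).1 = 3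
  degree_off : ∀ d ∈ K, (∀ i, (g i).1 ≠ d.1) → P.degree K d.1 = 4
  two : {d ∈ Set.range g | P.degree K d.1 = 2}.ncard = 2
  inSector : ∀ i, ∀ e ∈ H, e.1 = (g i).1 → e ∉ K → P.InSector K (g i) e

theorem IsTwoRegionOf.exists_isBoundedBy {H K : Set P.Dart} (h : P.IsTwoRegionOf H K) :
    ∃ g n, P.IsBoundedBy H K g n := by
  obtain ⟨h1, h2, -, F, hF, hinj, htwo, h23, h4, hsec⟩ := h
  obtain ⟨g, n, hg, rfl, hgK, hfol⟩ := exists_curve_of_isFaceOf h1 hF hinj h23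
  refine ⟨g, n, hg, h1, h2, hgK, hfol, fun i => h23 _ ⟨i, rfl⟩, fun d hd hoff => h4 d hd ?_, htwo,
    fun i => hsec _ ⟨i, rfl⟩⟩
  rintro ⟨_, ⟨i, rfl⟩, hi⟩
  exact hoff i hi

theorem mem_of_degree_four {K : Set P.Dart} {d e : P.Dart} (h : P.degree K d.1 = 4)
    (he : e.1 = d.1) : e ∈ K := by
  rw [degree_eq] at h
  rcases eq_or_turn he with rfl | rfl | rfl | rfl <;> by_contra hne <;> rw [if_neg hne] at h <;>
    split_ifs at h <;> omega

namespace IsBoundedBy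

variable {H K : Set P.Dart} {g : ℕ → P.Dart} {n : ℕ} (hK : P.IsBoundedBy H K g n)
include hK

theorem mem_of_onCurve {d : P.Dart} (hd : P.OnCurve g d) : d ∈ K := by
  obtain ⟨i, rfl | rfl⟩ := hd
  · exact hK.mem i
  · exact hK.mate_mem _ (hK.mem i)

theorem mem_at (i : ℕ) : g i ∈ H := hK.subset (hK.mem i)

theorem mate_mem_at (i : ℕ) : P.mate (g i) ∈ H := hK.subset (hK.mate_mem _ (hK.mem i))

theorem mem_of_off {d e : P.Dart} (hd : d ∈ K) (hoff : ∀ i, (g i).1 ≠ d.1) (he : e.1 = d.1) :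
    e ∈ K :=
  mem_of_degree_four (hK.degree_off d hd hoff) he

/-- A sweep through the sector starts at the left of `g i`, outside `T`, and meets no edge of the
curve, because these all belong to `K`. -/
theorem sector_faces {T : Set P.Face} (hT : P.IsSide g T) {i : ℕ} {e : P.Dart} (he : e ∈ H)
    (hei : e.1 = (g i).1) (heK : e ∉ K) : P.face e ∉ T ∧ P.face (P.turn e 3) ∉ T := by
  obtain ⟨k, h1, h3, hcl, rfl⟩ := hK.inSector i e he hei heK
  have key : ∀ j ≤ k, P.face (P.turn (g i) j) ∉ T := by
    intro j
    induction j with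
    | zero =>
      intro _
      rw [turn_zero]
      exact hT.left i
    | succ j ih =>
      intro hj
      have h := hT.turn_three (d := P.turn (g i) (j + 1))
        fun h => hcl (j + 1) (by omega) hj (hK.mem_of_onCurve h)
      rw [turn_turn, add_assoc, turn_add_four] at h
      exact fun h' => ih (by omega) (h.2 h')
  refine ⟨key k le_rfl, ?_⟩
  rw [turn_turn, show k + 3 = k - 1 + 4 by omega, turn_add_four]
  exact key _ (by omega)

/-- At a vertex where all half-edges belong to `H`, the curve `g` behaves like the boundary
of a region. -/
theorem turns_of_full {i : ℕ} (hH : ∀ e : P.Dart, e.1 = (g (i + 1)).1 → e ∈ H) :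
    (g (i + 1) = P.turn (P.mate (g i)) 1 ∧ P.degree K (g (i + 1)).1 = 2) ∨
      g (i + 1) = P.turn (P.mate (g i)) 2 := by
  obtain ⟨hm, k, hk, hcl, hk'⟩ := hK.follows i
  have hsec : ∀ l, l < 4 → P.turn (g (i + 1)) l ∉ K → P.Clear K (g (i + 1)) l := by
    intro l hl hlK
    obtain ⟨l', h1, h3, hcl', h⟩ := hK.inSector (i + 1) _ (hH (P.turn (g (i + 1)) l) rfl) rfl hlK
    rw [turn_eq_turn_iff _ hl (by omega)] at h
    rwa [h]
  have h0 := hK.mem (i + 1)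
  have hk3 : k ≠ 3 := by
    rintro rfl
    exact hK.curve.noback i (by rw [hk', turn_four])
  -- By the sector condition, the missing half-edges form a run directly after `g (i + 1)`. If the
  -- first is present then all are, and the degree would be 4.
  by_cases h1 : P.turn (g (i + 1)) 1 ∈ K
  · exfalso
    have h2 : P.turn (g (i + 1)) 2 ∈ K := by
      by_contra h
      exact hsec 2 (by norm_num) h 1 le_rfl (by norm_num) h1
    have h3 : P.turn (g (i + 1)) 3 ∈ K := by
      by_contra h
      exact hsec 3 (by norm_num) h 1 le_rfl (by norm_num) h1
    have := hK.degree_on (i + 1)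
    rw [degree_eq, if_pos h0, if_pos h1, if_pos h2, if_pos h3] at this
    omega
  rw [hk'] at hm
  have hk0 : k ≠ 0 := by
    rintro rfl
    exact h1 hm
  by_cases h2 : P.turn (g (i + 1)) 2 ∈ K
  · have hk1 : k = 1 := by
      by_contra hne
      exact hcl 2 (by norm_num) (by omega) h2
    refine Or.inr ?_
    rw [hk', turn_turn, hk1, turn_four]
  · have hk2 : k = 2 := by
      have : k ≠ 1 := by
        rintro rfl
        exact h2 hm
      omega
    rw [hk2] at hm
    refine Or.inl ⟨by rw [hk', turn_turn, hk2, turn_four], ?_⟩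
    rw [degree_eq, if_pos h0, if_neg h1, if_neg h2, if_pos hm]

end IsBoundedBy

/-! ### 2-regions in a region -/

theorem IsRegion.eq_of_mem_corner {c : ℕ → P.Dart} {n : ℕ} {S : Set P.Face}
    (hR : P.IsRegion c n S) {j : ℕ} (h : c (j + 1) = P.turn (P.mate (c j)) 1) {e : P.Dart}
    (he : e ∈ P.borderDarts S) (hej : e.1 = (c (j + 1)).1) :
    e = P.mate (c j) ∨ e = P.turn (P.mate (c j)) 1 := by
  obtain ⟨-, -, h2, h3⟩ := hR.corner_border h
  rw [hR.curve.step] at hej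
  rcases eq_or_turn hej with rfl | rfl | rfl | rfl
  · exact Or.inl rfl
  · exact Or.inr rfl
  · exact absurd he h2
  · exact absurd he h3

theorem IsRegion.eq_of_mem_straight {c : ℕ → P.Dart} {n : ℕ} {S : Set P.Face}
    (hR : P.IsRegion c n S) {j : ℕ} (h : c (j + 1) = P.turn (P.mate (c j)) 2) {e : P.Dart}
    (he : e ∈ P.borderDarts S) (hej : e.1 = (c (j + 1)).1) :
    e = P.mate (c j) ∨ e = P.turn (P.mate (c j)) 1 ∨ e = P.turn (P.mate (c j)) 2 := by
  obtain ⟨-, -, -, h3⟩ := hR.straight_border h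
  rw [hR.curve.step] at hej
  rcases eq_or_turn hej with rfl | rfl | rfl | rfl
  · exact Or.inl rfl
  · exact Or.inr (Or.inl rfl)
  · exact Or.inr (Or.inr rfl)
  · exact absurd he h3

/-- At the end of the step `j` of `c`, the graph `K` contains both half-edges of `c`, but the
curve `g` does not continue along `c`. -/
structure Departs (P : PDCode) (c g : ℕ → P.Dart) (K : Set P.Dart) (j : ℕ) : Prop where
  mate_mem : P.mate (c j) ∈ K
  mem : c (j + 1) ∈ K
  not_mem_range : c (j + 1) ∉ Set.range g

/-! ### How the boundary of a smaller 2-region passes the vertices of `c` -/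

namespace IsBoundedBy

variable {c g : ℕ → P.Dart} {n n' : ℕ} {S : Set P.Face} {K : Set P.Dart}
  (hR : P.IsRegion c n S) (hK : P.IsBoundedBy (P.borderDarts S) K g n')
include hR hK

/-- A vertex of `c` has degree at most 3 in the border graph, so a vertex of `K` there cannot be one
of the degree-4 vertices off `g`. -/
theorem exists_of_mem {j : ℕ} {d : P.Dart} (hd : d ∈ K) (hdj : d.1 = (c (j + 1)).1) :
    ∃ i, (g (i + 1)).1 = (c (j + 1)).1 := by
  by_contra hno
  have hoff : ∀ i, (g i).1 ≠ d.1 := by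
    intro i hi
    obtain ⟨l, hl⟩ := hK.curve.exists_pred i
    exact hno ⟨l, by rw [hl, hi, hdj]⟩
  have h3 : P.turn (P.mate (c j)) 3 ∈ K :=
    hK.mem_of_off hd hoff (by rw [hdj, hR.curve.step, turn_fst])
  rcases hR.turns j with h | h
  · exact (hR.corner_border h).2.2.2 (hK.subset h3)
  · exact (hR.straight_border h).2.2.2 (hK.subset h3)

theorem mate_eq_mate {i j : ℕ} (hm : P.mate (c j) ∈ K) (h : g (i + 1) = c (j + 1)) :
    P.mate (g i) = P.mate (c j) := by
  have hf := hK.follows i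
  rw [h] at hf
  rcases hR.turns j with h' | h'
  · obtain ⟨-, -, h2, h3⟩ := hR.corner_border h'
    rw [h'] at hf
    exact hf.unique_right
      (Follows.one hm (fun h => h2 (hK.subset h)) fun h => h3 (hK.subset h))
  · obtain ⟨-, -, -, h3⟩ := hR.straight_border h'
    rw [h'] at hf
    exact hf.unique_right (Follows.two hm fun h => h3 (hK.subset h))

theorem sector_mate {i j : ℕ} (hs : c (j + 1) = P.turn (P.mate (c j)) 2)
    (h : g (i + 1) = P.mate (c j)) (h1 : P.turn (P.mate (c j)) 1 ∈ K) :
    P.turn (P.mate (c j)) 2 ∈ K := by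
  by_contra h2
  obtain ⟨-, -, hb, -⟩ := hR.straight_border hs
  obtain ⟨k, hk1, hk3, hcl, hk⟩ := hK.inSector (i + 1) _ hb
    (by rw [h, turn_fst]) h2
  rw [h, turn_eq_turn_iff _ (by norm_num) (by omega)] at hk
  refine hcl 1 le_rfl (by omega) ?_
  rwa [h]

/-- `g` passes the end of the next step of `c` but does not arrive along that step. If `K` lacked
the following half-edge of `c`, the vertex would be straight and `g` would come from inside and
leave backwards along `c`; then the missing half-edge would not lie in the sector of the face. -/
theorem departs_succ {j : ℕ} (h : P.Departs c g K j) : P.Departs c g K (j + 1) := by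
  have hm := hK.mate_mem _ h.mem
  obtain ⟨i, hi⟩ := exists_of_mem hR hK hm (hR.curve.step (j + 1)).symm
  have hgv : (P.mate (g i)).1 = (c (j + 1 + 1)).1 := by rw [← hi, hK.curve.step]
  have hne : P.mate (g i) ≠ P.mate (c (j + 1)) := fun h' =>
    h.not_mem_range ⟨i, mate_injective h'⟩
  have hne' : g (i + 1) ≠ c (j + 1 + 1) := fun h' => hne (mate_eq_mate hR hK hm h')
  refine ⟨hm, ?_, ?_⟩
  · by_contra hb
    rcases hR.turns (j + 1) with hs | hs
    · rcases hR.eq_of_mem_corner hs (hK.mate_mem_at i) hgv with h1 | h1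
      · exact hne h1
      · refine hb ?_
        rw [hs, ← h1]
        exact hK.mate_mem _ (hK.mem i)
    · have hb' : ∀ e ∈ K, e ≠ P.turn (P.mate (c (j + 1))) 2 := by
        rintro e he rfl
        exact hb (hs ▸ he)
      rcases hR.eq_of_mem_straight hs (hK.mate_mem_at i) hgv with h1 | h1 | h1
      · exact hne h1
      · have h1K : P.turn (P.mate (c (j + 1))) 1 ∈ K := h1 ▸ hK.mate_mem _ (hK.mem i)
        rcases hR.eq_of_mem_straight hs (hK.mem_at (i + 1)) hi with h2 | h2 | h2
        · exact hb' _ (sector_mate hR hK hs h2 h1K) rfl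
        · exact hK.curve.noback i (h2.trans h1.symm)
        · exact hb' _ (hK.mem _) h2
      · exact hb' _ (hK.mate_mem _ (hK.mem i)) h1
  · rintro ⟨l, hl⟩
    refine hne' ?_
    rw [← hl]
    exact hK.curve.eq_of_fst (hi.trans (congrArg Prod.fst hl.symm))

/-- Without a departure, `g` either follows `c`, or leaves it for the inner half-edge `turn 1`, or
joins it from there. The last two are right turns at a vertex of degree 2; the sector condition
excludes everything else. -/
theorem not_departs_local {i j : ℕ} (hi : (g (i + 1)).1 = (c (j + 1)).1)
    (hnd : ¬ P.Departs c g K j) :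
    g (i + 1) ≠ P.mate (c j) ∧
      ((g (i + 1) = P.turn (P.mate (g i)) 1 ∧ P.degree K (g (i + 1)).1 = 2) ∨
        g (i + 1) = P.turn (P.mate (g i)) 2) ∧
      (c (j + 1) ∈ K → P.OnCurve g (c (j + 1))) := by
  have hgv : (P.mate (g i)).1 = (c (j + 1)).1 := by rw [← hi, hK.curve.step]
  have hb' := hK.mem (i + 1)
  have hm' := hK.mate_mem _ (hK.mem i)
  have hnb := hK.curve.noback i
  have hdep : P.mate (c j) ∈ K → c (j + 1) ∈ K →
      g (i + 1) = c (j + 1) ∧ P.mate (g i) = P.mate (c j) := by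
    intro h1 h2
    have h : g (i + 1) = c (j + 1) := by
      by_contra hne
      refine hnd ⟨h1, h2, ?_⟩
      rintro ⟨l, hl⟩
      refine hne ?_
      rw [← hl]
      exact hK.curve.eq_of_fst (hi.trans (congrArg Prod.fst hl.symm))
    exact ⟨h, mate_eq_mate hR hK h1 h⟩
  have hon : g (i + 1) = c (j + 1) → P.OnCurve g (c (j + 1)) := fun h => ⟨i + 1, Or.inl h.symm⟩
  have hd := degree_eq K (P.mate (c j))
  rw [← hR.curve.step, ← hi] at hd
  have hcm : c (j + 1) ≠ P.mate (c j) := hR.curve.noback j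
  rcases hR.turns j with hs | hs
  · obtain ⟨-, -, h2, h3⟩ := hR.corner_border hs
    rw [if_neg fun h => h2 (hK.subset h), if_neg fun h => h3 (hK.subset h)] at hd
    have hboth : P.mate (c j) ∈ K ∧ c (j + 1) ∈ K := by
      rw [hs]
      rcases hR.eq_of_mem_corner hs (hK.mem_at (i + 1)) hi with h | h <;>
        rcases hR.eq_of_mem_corner hs (hK.mate_mem_at i) hgv with h' | h'
      · exact absurd (h.trans h'.symm) hnb
      · exact ⟨h ▸ hb', h' ▸ hm'⟩
      · exact ⟨h' ▸ hm', h ▸ hb'⟩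
      · exact absurd (h.trans h'.symm) hnb
    obtain ⟨h, h'⟩ := hdep hboth.1 hboth.2
    refine ⟨h ▸ hcm, Or.inl ⟨by rw [h, h', hs], ?_⟩, fun _ => hon h⟩
    rw [hd, if_pos hboth.1, if_pos (hs ▸ hboth.2)]
  · obtain ⟨hm, -, -, h3⟩ := hR.straight_border hs
    rw [if_neg (c := P.turn (P.mate (c j)) 3 ∈ K) fun h => h3 (hK.subset h)] at hd
    by_cases hmK : P.mate (c j) ∈ K
    · by_cases hbK : c (j + 1) ∈ K
      · obtain ⟨h, h'⟩ := hdep hmK hbK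
        exact ⟨h ▸ hcm, Or.inr (by rw [h, h', hs]), fun _ => hon h⟩
      · rw [hs] at hbK
        have key : g (i + 1) = P.turn (P.mate (c j)) 1 ∧ P.mate (g i) = P.mate (c j) := by
          rcases hR.eq_of_mem_straight hs (hK.mem_at (i + 1)) hi with h | h | h <;>
            rcases hR.eq_of_mem_straight hs (hK.mate_mem_at i) hgv with h' | h' | h'
          · exact absurd (h.trans h'.symm) hnb
          · exact absurd (sector_mate hR hK hs h (h' ▸ hm')) hbK
          · exact absurd (h' ▸ hm') hbK
          · exact ⟨h, h'⟩
          · exact absurd (h.trans h'.symm) hnb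
          · exact absurd (h' ▸ hm') hbK
          all_goals exact absurd (h ▸ hb') hbK
        refine ⟨fun h => turn_ne (P.mate (c j)) (k := 1) (by norm_num) (by norm_num) ?_,
          Or.inl ⟨by rw [key.1, key.2], ?_⟩, fun h => absurd (hs ▸ h) hbK⟩
        · rw [← key.1, h]
        · rw [hd, if_pos hmK, if_pos (key.1 ▸ hb'), if_neg hbK]
    · have key : g (i + 1) = P.turn (P.mate (c j)) 2 ∧ P.mate (g i) = P.turn (P.mate (c j)) 1 := by
        rcases hR.eq_of_mem_straight hs (hK.mem_at (i + 1)) hi with h | h | h <;>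
          rcases hR.eq_of_mem_straight hs (hK.mate_mem_at i) hgv with h' | h' | h'
        · exact absurd (h.trans h'.symm) hnb
        · exact absurd (h ▸ hb') hmK
        · exact absurd (h ▸ hb') hmK
        · exact absurd (h' ▸ hm') hmK
        · exact absurd (h.trans h'.symm) hnb
        · exfalso
          obtain ⟨k, hk1, hk3, hcl, hk⟩ := hK.inSector (i + 1) _ hm
            (by rw [hi, hR.curve.step]) hmK
          refine hcl 1 le_rfl hk1 ?_
          rw [h, turn_turn, ← h']
          exact hm'
        · exact absurd (h' ▸ hm') hmK
        · exact ⟨h, h'⟩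
        · exact absurd (h.trans h'.symm) hnb
      refine ⟨fun h => hmK (h ▸ hb'), Or.inl ⟨by rw [key.1, key.2, turn_turn], ?_⟩,
        fun _ => hon (key.1.trans hs.symm)⟩
      rw [hd, if_neg hmK, if_pos (key.2 ▸ hm'), if_pos (key.1 ▸ hb')]

/-- Half-edges that do not belong to a 2-region lie in its face. -/
theorem faces_of_not_mem (hl : P.Linked) {T : Set P.Face} (hT : P.IsSide g T) {d : P.Dart}
    (hd : d ∈ P.borderDarts S) (hdK : d ∉ K) : P.face d ∉ T ∧ P.face (P.mate d) ∉ T := by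
  have h := hR.connected hl hd (hK.mem_at 0)
  induction h using Relation.ReflTransGen.head_induction_on with
  | refl => exact absurd (hK.mem 0) hdK
  | @head a b h _ ih =>
    obtain ⟨ha, hb, rfl | hab⟩ := h
    · have := ih hb fun h => hdK (by simpa using hK.mate_mem _ h)
      rw [mate_mate] at this
      exact this.symm
    · rw [face_mate]
      by_cases hex : ∃ i, (g i).1 = a.1
      · obtain ⟨i, hi⟩ := hex
        exact hK.sector_faces hT ha hi.symm hdK
      · push Not at hex
        have h := (ih hb fun h => hdK (hK.mem_of_off h (by rwa [hab]) hab.symm)).1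
        have hex' : ∀ i, (g i).1 ≠ b.1 := by rwa [hab]
        exact ⟨by rwa [hT.constant hK.curve hex' hab.symm],
          by rwa [hT.constant hK.curve hex' (e := P.turn a 3) hab.symm]⟩

/-- A 2-region of a region that never departs from the boundary is a region. -/
theorem isRegion_inter (hl : P.Linked) (hnd : ∀ j, ¬ P.Departs c g K j) {T : Set P.Face}
    (hT : P.IsSide g T) : P.IsRegion g n' (T ∩ S) ∧ (P.corners g).ncard ≤ 2 := by
  have hturn : ∀ i, (g (i + 1) = P.turn (P.mate (g i)) 1 ∧ P.degree K (g (i + 1)).1 = 2) ∨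
      g (i + 1) = P.turn (P.mate (g i)) 2 := by
    intro i
    by_cases hex : ∃ j, (c j).1 = (g (i + 1)).1
    · obtain ⟨j, hj⟩ := hex
      obtain ⟨l, hl'⟩ := hR.curve.exists_pred j
      rw [← hl'] at hj
      exact (not_departs_local hR hK hj.symm (hnd l)).2.1
    · push Not at hex
      exact hK.turns_of_full fun e he =>
        Or.inl (hR.face_mem_of_off (hK.mem_at (i + 1)) hex he)
  refine ⟨⟨hK.curve, hR.side.inter hT (fun i => ?_) (fun i hi => ?_), fun i => ?_⟩, ?_⟩
  · by_cases hon : P.OnCurve c (g i)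
    · obtain ⟨j, h | h⟩ := hon
      · rw [h]
        exact hR.side.right j
      · exfalso
        obtain ⟨l, hl'⟩ := hK.curve.exists_pred i
        rw [← hl'] at h
        refine (not_departs_local hR hK (i := l) (j := j) ?_ (hnd j)).1 h
        rw [h, hR.curve.step]
    · rcases hK.mem_at i with h | h
      · exact (hR.side.cross _ hon).1 h
      · exact h
  · have hciK : c i ∉ K := by
      intro hciK
      obtain ⟨j, hj⟩ := hR.curve.exists_pred i
      rw [← hj] at hi hciK
      obtain ⟨l, hl'⟩ := exists_of_mem hR hK hciK rfl
      exact hi ((not_departs_local hR hK hl' (hnd j)).2.2 hciK)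
    exact (faces_of_not_mem hR hK hl hT (hR.mem_border i) hciK).2
  · exact (hturn i).imp And.left id
  · rw [← hK.two]
    refine Set.ncard_le_ncard ?_
    rintro _ ⟨i, rfl, hi⟩
    refine ⟨⟨i + 1, rfl⟩, ((hturn i).resolve_right fun h => ?_).2⟩
    exact not_corner_of_straight h hi

/-- If the curve `g` visits all vertices of `c`, the graphs agree there. -/
theorem mem_of_visits (h2 : (P.corners c).ncard = 2) (hv : ∀ j, ∃ i, (g i).1 = (c j).1) :
    (∀ e ∈ P.borderDarts S, ∀ j, e.1 = (c j).1 → e ∈ K) ∧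
      ∀ i, P.degree K (g i).1 = 2 → ∃ j, (c j).1 = (g i).1 := by
  set W := {d ∈ Set.range g | P.degree K d.1 = 2} with hW
  have hdle : ∀ d : P.Dart, P.degree K d.1 ≤ P.degree (P.borderDarts S) d.1 := fun d =>
    Set.ncard_le_ncard fun i hi => hK.subset hi
  -- Corners of `c` have degree 2 in the larger graph, hence also in `K`. Both graphs have exactly
  -- two such vertices, so these are all, and the straight vertices of `c` keep degree 3 in `K`.
  have hsub : Prod.fst '' P.corners c ⊆ Prod.fst '' W := by
    rintro _ ⟨_, ⟨j, rfl, hj⟩, rfl⟩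
    obtain ⟨i, hi⟩ := hv (j + 1)
    refine ⟨g i, ⟨⟨i, rfl⟩, ?_⟩, hi⟩
    have h1 := hdle (c (j + 1))
    rw [hR.degree_corner hj, ← hi] at h1
    rcases hK.degree_on i with h | h <;> omega
  have hcW : (Prod.fst '' P.corners c).ncard = 2 := by
    rw [Set.InjOn.ncard_image, h2]
    rintro _ ⟨i, rfl, -⟩ _ ⟨j, rfl, -⟩ h
    exact hR.curve.eq_of_fst h
  have hWle : (Prod.fst '' W).ncard ≤ (Prod.fst '' P.corners c).ncard := by
    rw [hcW, ← hK.two]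
    exact Set.ncard_image_le
  have heq := Set.eq_of_subset_of_ncard_le hsub hWle
  have hcor : ∀ i, P.degree K (g i).1 = 2 →
      ∃ j, (c (j + 1)).1 = (g i).1 ∧ c (j + 1) = P.turn (P.mate (c j)) 1 := by
    intro i hi
    have : (g i).1 ∈ Prod.fst '' W := ⟨g i, ⟨⟨i, rfl⟩, hi⟩, rfl⟩
    rw [← heq] at this
    obtain ⟨_, ⟨j, rfl, hj⟩, h⟩ := this
    exact ⟨j, h, hj⟩
  refine ⟨fun e he j hej => ?_, fun i hi => ?_⟩
  · obtain ⟨l, hl⟩ := hR.curve.exists_pred j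
    rw [← hl] at hej
    obtain ⟨i, hi⟩ := hv (l + 1)
    have hdeg : P.degree (P.borderDarts S) e.1 ≤ P.degree K e.1 := by
      rw [hej]
      rcases hR.turns l with hs | hs
      · rw [hR.degree_corner hs, ← hi]
        rcases hK.degree_on i with h | h <;> omega
      · rw [hR.degree_straight hs, ← hi]
        rcases hK.degree_on i with h | h
        · obtain ⟨k, hk, hk'⟩ := hcor i h
          have h5 := hR.curve.eq_of_fst (hk.trans hi)
          have h6 := hR.degree_corner hk'
          rw [h5, hR.degree_straight hs] at h6
          omega
        · omega
    have h7 : {i : ZMod 4 | (e.1, i) ∈ K} = {i : ZMod 4 | (e.1, i) ∈ P.borderDarts S} :=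
      Set.eq_of_subset_of_ncard_le (fun i hi => hK.subset hi) hdeg
    have h8 : e.2 ∈ {i : ZMod 4 | (e.1, i) ∈ P.borderDarts S} := he
    rw [← h7] at h8
    exact h8
  · obtain ⟨j, hj, -⟩ := hcor i hi
    exact ⟨j + 1, hj⟩

end IsBoundedBy

/-! ### Minimality -/

theorem IsBoundedBy.subset_of_closed {c g : ℕ → P.Dart} {n n' : ℕ} {S : Set P.Face}
    {K : Set P.Dart} (hR : P.IsRegion c n S) (hK : P.IsBoundedBy (P.borderDarts S) K g n')
    (hl : P.Linked) (A : Set P.Dart) (hA0 : c 0 ∈ A) (hAm : ∀ d ∈ A, P.mate d ∈ A) (hAK : A ⊆ K)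
    (hA : ∀ d ∈ A, ∀ e ∈ P.borderDarts S, e.1 = d.1 → e ∈ A) : K = P.borderDarts S := by
  refine Set.Subset.antisymm hK.subset fun e he => hAK ?_
  have h := hR.connected hl (hR.mem_border 0) he
  clear he
  induction h with
  | refl => exact hA0
  | tail _ h ih =>
    obtain ⟨-, hb, rfl | h⟩ := h
    · exact hAm _ ih
    · exact hA _ ih _ hb h

/-- By minimality `S ⊆ T`, so each edge of `g` has `S` on its right only and therefore lies on `c`.
Thus `g` and `c` have the same steps, and `K` contains everything that is connected to them. -/
theorem IsBoundedBy.eq_of_not_departs {c g : ℕ → P.Dart} {n n' : ℕ} {S : Set P.Face}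
    {K : Set P.Dart} (hM : P.IsMinimalRegion c n S) (h2 : (P.corners c).ncard = 2)
    (hK : P.IsBoundedBy (P.borderDarts S) K g n') (hJ : P.HasSides) (hl : P.Linked)
    (hnd : ∀ j, ¬ P.Departs c g K j) : K = P.borderDarts S := by
  have hR := hM.region
  obtain ⟨T, hT⟩ := hJ g n' hK.curve
  obtain ⟨hR', hcard⟩ := hK.isRegion_inter hR hl hnd hT
  have hST : S ⊆ T := by
    by_contra hno
    exact hM.minimal g n' _ hR' hcard
      ⟨Set.inter_subset_right, fun h => hno (h.trans Set.inter_subset_left)⟩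
  have hgc : ∀ i, ∃ j, g i = c j := by
    intro i
    have h1 : P.face (g i) ∉ S := fun h => hT.left i (hST h)
    have h3 : P.face (P.mate (g i)) ∈ S := (hK.mem_at i).resolve_left h1
    by_cases hon : P.OnCurve c (g i)
    · obtain ⟨j, h | h⟩ := hon
      · exact ⟨j, h⟩
      · rw [h, mate_mate] at h3
        exact absurd h3 (hR.side.left j)
    · exact absurd ((hR.side.cross _ hon).2 h3) h1
  have hcg : ∀ j, ∃ i, g i = c j := by
    obtain ⟨j₀, hj₀⟩ := hgc 0
    have key : ∀ k, ∃ i, g i = c (j₀ + k) := by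
      intro k
      induction k with
      | zero => exact ⟨0, hj₀⟩
      | succ k ih =>
        obtain ⟨i, hi⟩ := ih
        obtain ⟨l, hl'⟩ := hgc (i + 1)
        refine ⟨i + 1, ?_⟩
        rw [hl']
        refine hR.curve.eq_of_fst ?_
        rw [← hl', hK.curve.step, hi, ← hR.curve.step]
        rfl
    intro j
    obtain ⟨k, -, hk, -⟩ := hR.curve.exists_shift j₀ j
    obtain ⟨i, hi⟩ := key k
    exact ⟨i, hi.trans hk⟩
  have hagree := (hK.mem_of_visits hR h2 fun j => (hcg j).imp fun i hi => congrArg Prod.fst hi).1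
  refine hK.subset_of_closed hR hl K (hagree _ (hR.mem_border 0) 0 rfl) hK.mate_mem subset_rfl
    fun d hd e he hed => ?_
  by_cases hex : ∃ j, (c j).1 = d.1
  · obtain ⟨j, hj⟩ := hex
    exact hagree e he j (hed.trans hj.symm)
  · refine hK.mem_of_off hd (fun i hi => hex ?_) hed
    obtain ⟨j, hj⟩ := hgc i
    exact ⟨j, by rw [← hj, hi]⟩

/-- In a minimal region with a chord, no closed curve runs along the chord and through all vertices
of the boundary. -/
theorem IsMinimalRegion.not_visits_of_chord {c g : ℕ → P.Dart} {n n' : ℕ} {S : Set P.Face}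
    (hM : P.IsMinimalRegion c n S) (hJ : P.HasSides) {d : P.Dart} {N s t : ℕ}
    (hch : P.IsChord c d N s t) (hs : s + 1 < n) (ht : t + 1 = n) (hg : P.IsCurve g n')
    (hgS : ∀ i, g i ∈ P.borderDarts S) (hgd : ∀ j < N, g j = P.straight^[j] d)
    (hv : ∀ j, ∃ i, (g i).1 = (c j).1) : False := by
  have hR := hM.region
  have hc := hR.curve
  have h0 := hch.pos
  obtain ⟨-, -, T, -, hTS, -, hcross, hin, hout⟩ := hR.exists_cut hJ hch hs ht
  have hd1 : d.1 = (c (s + 1)).1 := by rw [hch.start, hc.step, turn_fst]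
  have hgN : (g N).1 = (P.straight^[N] d).1 := by
    rw [show N = N - 1 + 1 by omega, hg.step, hgd _ (by omega), iterate_succ_fst]
  have hdN : (P.straight^[N] d).1 = (c 0).1 := by
    rw [show N = N - 1 + 1 by omega, iterate_succ_fst, hch.finish, turn_fst, ← hc.step, ht,
      ← hc.periodic 0, zero_add]
  have hTS' : ∀ f, f ∉ S → f ∉ T := fun f h h' => h (hTS.1 h')
  have hcross' : ∀ y : P.Dart, (∀ j ≤ N, (P.straight^[j] d).1 ≠ y.1) → P.face y ∈ S →
      P.face (P.turn y 3) ∈ S → (P.face y ∈ T ↔ P.face (P.turn y 3) ∈ T) := by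
    intro y hy h1 h2
    rw [← face_mate] at h2 ⊢
    refine hcross y (fun j hj => ⟨?_, ?_⟩) h1 h2
    · rintro rfl
      exact hy j hj.le rfl
    · rintro rfl
      exact hy (j + 1) hj (iterate_succ_fst d j)
  -- Inside `S` only the chord separates `T` from the rest. So at a vertex off the chord either all
  -- half-edges of the border graph border `T` or none does.
  have hvert : ∀ y y' : P.Dart, y ∈ P.borderDarts S → y' ∈ P.borderDarts S → y'.1 = y.1 →
      (∀ j ≤ N, (P.straight^[j] d).1 ≠ y.1) →
      (y ∈ P.borderDarts T ↔ y' ∈ P.borderDarts T) := by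
    intro y y' hy hy' hyy hoff
    rw [mem_borderDarts, mem_borderDarts]
    by_cases hex : ∃ j, (c j).1 = y.1
    · obtain ⟨j, hj⟩ := hex
      obtain ⟨l, hl⟩ := hc.exists_pred j
      rw [← hl] at hj
      have hm3 := hTS' _ (hR.side.turn_mate_three l)
      rcases hR.turns l with h | h
      · have hb := hTS' _ (hR.side.left (l + 1))
        rw [h] at hb
        have key : ∀ e, e = P.mate (c l) ∨ e = P.turn (P.mate (c l)) 1 →
            ((P.face e ∈ T ∨ P.face (P.turn e 3) ∈ T) ↔ P.face (P.mate (c l)) ∈ T) := by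
          rintro e (rfl | rfl)
          · tauto
          · rw [turn_turn, turn_four]
            tauto
        rw [key _ (hR.eq_of_mem_corner h hy hj.symm),
          key _ (hR.eq_of_mem_corner h hy' (hyy.trans hj.symm))]
      · have hb := hTS' _ (hR.side.left (l + 1))
        rw [h] at hb
        have h1 := hcross' (P.turn (P.mate (c l)) 1)
          (fun j hj' => by rw [turn_fst, ← hc.step, hj]; exact hoff j hj')
          (hR.side.straight_one hc h) (by rw [turn_turn, turn_four]; exact hR.side.right l)
        rw [turn_turn, turn_four] at h1
        have key : ∀ e, e = P.mate (c l) ∨ e = P.turn (P.mate (c l)) 1 ∨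
              e = P.turn (P.mate (c l)) 2 →
            ((P.face e ∈ T ∨ P.face (P.turn e 3) ∈ T) ↔ P.face (P.mate (c l)) ∈ T) := by
          rintro e (rfl | rfl | rfl)
          · tauto
          · rw [turn_turn, turn_four]
            tauto
          · rw [turn_turn, turn_five]
            tauto
        rw [key _ (hR.eq_of_mem_straight h hy hj.symm),
          key _ (hR.eq_of_mem_straight h hy' (hyy.trans hj.symm))]
    · push Not at hex
      have hS : ∀ e : P.Dart, e.1 = y.1 → P.face e ∈ S := fun e he => hR.face_mem_of_off hy hex he
      have h3 : ∀ e : P.Dart, e.1 = y.1 → (P.face e ∈ T ↔ P.face (P.turn e 3) ∈ T) := fun e he =>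
        hcross' e (by rwa [he]) (hS e he) (hS _ he)
      have ha := h3 y rfl
      have hb := h3 (P.turn y 3) rfl
      have hc := h3 (P.turn y 2) rfl
      rw [turn_turn] at hb hc
      simp only [Nat.reduceAdd, turn_five, turn_six] at hb hc
      rcases eq_or_turn hyy with rfl | rfl | rfl | rfl <;> simp only [turn_turn, Nat.reduceAdd,
        turn_four, turn_five, turn_six] <;> tauto
  have hmate : ∀ y, y ∈ P.borderDarts T ↔ P.mate y ∈ P.borderDarts T := fun y =>
    ⟨mate_mem_borderDarts, fun h => by simpa using mate_mem_borderDarts h⟩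
  have hgoff : ∀ i, N < i → i < n' → ∀ j ≤ N, (P.straight^[j] d).1 ≠ (g i).1 := by
    intro i h1 h2 j hj h
    have hj' : (g j).1 = (P.straight^[j] d).1 := by
      rcases Nat.lt_or_ge j N with h' | h'
      · rw [hgd j h']
      · obtain rfl : j = N := by omega
        exact hgN
    have := hg.inj j (by omega) i h2 (hj'.trans h)
    omega
  -- Being simple, `g` does not meet the chord again before it closes up, so it remains in one of
  -- the two parts.
  have hconst : ∀ i, N + 1 + i < n' → (g (N + 1 + i) ∈ P.borderDarts T ↔
      g (N + 1) ∈ P.borderDarts T) := by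
    intro i
    induction i with
    | zero => exact fun _ => Iff.rfl
    | succ i ih =>
      intro hi
      rw [← ih (by omega), hmate (g (N + 1 + i))]
      exact hvert _ _ (hgS _) (mate_mem_borderDarts (hgS _)) (hg.step _).symm
        (hgoff _ (by omega) hi)
  have hcoff : ∀ i, i + 1 < n → i ≠ s → ∀ j ≤ N, (P.straight^[j] d).1 ≠ (c (i + 1)).1 := by
    intro i hi his j hj h
    rcases Nat.eq_zero_or_pos j with rfl | hj0
    · rw [Function.iterate_zero, id, hd1] at h
      have := hc.inj _ hs _ hi h
      omega
    · rcases Nat.lt_or_ge j N with hjN | hjN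
      · exact hch.off j hj0 hjN _ h.symm
      · obtain rfl : j = N := by omega
        rw [hdN] at h
        have := hc.inj 0 (by omega) _ hi h
        omega
  have hvisit : ∀ i, i + 1 < n → i ≠ s →
      (g (N + 1) ∈ P.borderDarts T ↔ P.face (P.mate (c i)) ∈ T) := by
    intro i hi his
    obtain ⟨l, hl⟩ := hv (i + 1)
    rw [← hg.apply_mod] at hl
    have hlt := hg.mod_lt l
    have hNl : N < l % n' := by
      by_contra hle
      refine hcoff i hi his (l % n') (by omega) ?_
      rw [← hl]
      rcases Nat.lt_or_ge (l % n') N with h | h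
      · rw [hgd _ h]
      · rw [show l % n' = N by omega, hgN]
    have h1 := hconst (l % n' - (N + 1)) (by omega)
    rw [show N + 1 + (l % n' - (N + 1)) = l % n' by omega] at h1
    rw [← h1, hvert _ (P.mate (c i)) (hgS _) (mate_mem_borderDarts (hR.mem_border i))
      (by rw [hl, hc.step]) (by rw [hl]; exact hcoff i hi his), mem_borderDarts,
      or_iff_left (hTS' _ (hR.side.turn_mate_three i))]
  -- Each arc of `c` has a corner away from the ends of the chord. One of them belongs to `T` and
  -- the other does not, but `g` would visit both.
  obtain ⟨⟨i₁, hi₁, -⟩, i₂, hi₂, hi₂', -⟩ := hM.exists_corners hJ hch hs ht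
  exact hout i₂ hi₂ (by omega) ((hvisit i₂ hi₂' (by omega)).1
    ((hvisit i₁ (by omega) (by omega)).2 (hin i₁ (by omega))))

/-- Off `c` the curve `g` goes straight, so once it takes the first half-edge of the chord it runs
along the whole chord. -/
theorem IsMinimalRegion.not_visits_of_chord_start {c g : ℕ → P.Dart} {n n' : ℕ} {S : Set P.Face}
    (hM : P.IsMinimalRegion c n S) (hJ : P.HasSides) {d : P.Dart} {N s t : ℕ}
    (hch : P.IsChord c d N s t) (hg : P.IsCurve g n') (hgS : ∀ i, g i ∈ P.borderDarts S)
    (hstr : ∀ i, (∀ j, (c j).1 ≠ (g (i + 1)).1) → g (i + 1) = P.straight (g i))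
    (hd : d ∈ Set.range g) (hv : ∀ j, ∃ i, (g i).1 = (c j).1) : False := by
  obtain ⟨i₀, hi₀⟩ := hd
  obtain ⟨k, s', hs', hch'⟩ := hch.exists_shift hM.region.curve
  have hn := hM.region.curve.pos
  refine (hM.shift k).not_visits_of_chord hJ hch' hs' (by omega) (hg.shift i₀)
    (fun i => hgS _) (fun j hj => ?_) fun j => ?_
  · induction j with
    | zero => exact hi₀
    | succ j ih =>
      have h := ih (by omega)
      change g (i₀ + j) = _ at h
      rw [Function.iterate_succ_apply', ← h]
      refine hstr _ fun l hl => hch.off (j + 1) (by omega) hj l ?_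
      change _ = (g (i₀ + j + 1)).1 at hl
      rw [hl, hg.step, h, iterate_succ_fst]
  · obtain ⟨i, hi⟩ := hv (k + j)
    obtain ⟨l, -, hl, -⟩ := hg.exists_shift i₀ i
    exact ⟨l, by rw [hl, hi]⟩

theorem IsBoundedBy.eq_of_departs {c g : ℕ → P.Dart} {n n' : ℕ} {S : Set P.Face}
    {K : Set P.Dart} (hM : P.IsMinimalRegion c n S) (h2 : (P.corners c).ncard = 2)
    (hK : P.IsBoundedBy (P.borderDarts S) K g n') (hJ : P.HasSides) (hl : P.Linked) {j₀ : ℕ}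
    (hj₀ : P.Departs c g K j₀) : K = P.borderDarts S := by
  have hR := hM.region
  have hdep : ∀ j, P.Departs c g K (j₀ + j) := by
    intro j
    induction j with
    | zero => exact hj₀
    | succ j ih => exact hK.departs_succ hR ih
  have hv : ∀ j, ∃ i, (g i).1 = (c j).1 := by
    intro j
    obtain ⟨k, -, hk, -⟩ := hR.curve.exists_shift (j₀ + 1) j
    rw [add_right_comm] at hk
    obtain ⟨i, hi⟩ := hK.exists_of_mem hR (hdep k).mem rfl
    exact ⟨i + 1, by rw [hi, hk]⟩
  obtain ⟨hagree, hdeg⟩ := hK.mem_of_visits hR h2 hv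
  by_cases hex : ∃ s, c (s + 1) = P.turn (P.mate (c s)) 2
  · exfalso
    obtain ⟨s, hs⟩ := hex
    obtain ⟨N, t, hch⟩ := hM.exists_chord hJ hs
    have hstr : ∀ i, (∀ j, (c j).1 ≠ (g (i + 1)).1) → g (i + 1) = P.straight (g i) := by
      intro i hoff
      refine (hK.turns_of_full fun e he => ?_).resolve_left fun h => ?_
      · exact Or.inl (hR.face_mem_of_off (hK.mem_at (i + 1)) hoff he)
      · obtain ⟨j, hj⟩ := hdeg _ h.2
        exact hoff j hj
    obtain ⟨k, -, hk, -⟩ := hR.curve.exists_shift j₀ s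
    have hnr := (hdep k).not_mem_range
    rw [hR.curve.succ_eq hk] at hnr
    obtain ⟨i, hi⟩ := hv (s + 1)
    obtain ⟨i', hi'⟩ := hK.curve.exists_pred i
    rw [← hi'] at hi
    set d := P.turn (P.mate (c s)) 1 with hd
    have hdK : d ∈ K := hagree d (hR.straight_border hs).2.1 (s + 1)
      (by rw [hd, turn_fst, hR.curve.step])
    -- At a straight vertex of `c`, `g` may leave backwards along `c`, and then it came in along the
    -- chord, which is traced back to its other end; or it leaves along the chord; leaving along `c`
    -- is excluded by the departure.
    rcases hR.eq_of_mem_straight hs (hK.mem_at (i' + 1)) hi with h | h | h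
    · have hf : P.Follows K (P.mate (c s)) d :=
        ⟨hdK, 0, by norm_num, fun k h1 h2 => by omega, rfl⟩
      have hf' := hK.follows i'
      rw [h] at hf'
      have hmd : P.mate d ∈ Set.range g := ⟨i', by rw [← hf'.unique_right hf, mate_mate]⟩
      have hback : ∀ j < N, P.mate (P.straight^[j] d) ∈ Set.range g := by
        intro j
        induction j with
        | zero => exact fun _ => hmd
        | succ j ih =>
          intro hj
          obtain ⟨l, hl'⟩ := ih (by omega)
          obtain ⟨l', h'⟩ := hK.curve.exists_pred l
          rw [← h'] at hl'
          have hst := hstr l' fun q hq => hch.off (j + 1) (by omega) hj q (by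
            rw [hq, hl', iterate_succ_fst])
          refine ⟨l', mate_injective ?_⟩
          rw [mate_mate, mate_eq_turn_straight, ← hst, hl', Function.iterate_succ_apply']
          rfl
      have h0 := hch.pos
      exact hM.not_visits_of_chord_start hJ (hch.reverse hR.curve.step) hK.curve hK.mem_at hstr
        (hback (N - 1) (by omega)) hv
    · exact hM.not_visits_of_chord_start hJ hch hK.curve hK.mem_at hstr ⟨i' + 1, h⟩ hv
    · exact hnr ⟨i' + 1, h.trans hs.symm⟩
  -- If every vertex of `c` is a corner, no further edge of the border graph is attached to `c`, so
  -- `c` is the whole graph.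
  · have hcor : ∀ j, c (j + 1) = P.turn (P.mate (c j)) 1 := fun j =>
      (hR.turns j).resolve_right fun h => hex ⟨j, h⟩
    refine hK.subset_of_closed hR hl {d | d ∈ P.borderDarts S ∧ P.OnCurve c d}
      ⟨hR.mem_border 0, 0, Or.inl rfl⟩
      (fun d hd => ⟨mate_mem_borderDarts hd.1, onCurve_mate.2 hd.2⟩) (fun d hd => ?_)
      fun d hd e he hed => ⟨he, ?_⟩
    · obtain ⟨j, hj⟩ := hR.curve.exists_fst_of_onCurve hd.2
      exact hagree d hd.1 j hj.symm
    · obtain ⟨j, hj⟩ := hR.curve.exists_fst_of_onCurve hd.2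
      obtain ⟨l, hl'⟩ := hR.curve.exists_pred j
      rw [← hl'] at hj
      rcases hR.eq_of_mem_corner (hcor l) he (hed.trans hj.symm) with h | h
      · exact ⟨l, Or.inr h⟩
      · exact ⟨l + 1, Or.inl (h.trans (hcor l).symm)⟩

theorem exists_minimal_twoRegion (hJ : P.HasSides) (hl : P.Linked) (d : P.Dart)
    (hred : ∀ d : P.Dart, P.face d ≠ P.face (P.turn d 2)) :
    ∃ H, P.IsTwoRegionOf Set.univ H ∧ ∀ K, P.IsTwoRegionOf H K → K = H := by
  obtain ⟨c, n, S, hM⟩ := exists_isMinimalRegion hJ d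
  have h2 := hM.ncard_corners hJ hred
  refine ⟨P.borderDarts S, hM.region.isTwoRegionOf hl h2, fun K hK => ?_⟩
  obtain ⟨g, n', hg⟩ := hK.exists_isBoundedBy
  by_cases hdep : ∃ j, P.Departs c g K j
  · obtain ⟨j, hj⟩ := hdep
    exact hg.eq_of_departs hM h2 hJ hl hj
  · exact hg.eq_of_not_departs hM h2 hJ hl fun j hj => hdep ⟨j, hj⟩

end PDCode

/-! ### Diagrams of links that are not split -/

/-- Without crossings every arc is a piece by itself, so a connected diagram is a single closed
curve. -/
theorem LinkDiagram.nonempty_of_ne_unknot {D : LinkDiagram} (hc : D.IsConnected)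
    (hne : D.link ≠ Link.unknot) : Nonempty D.X := by
  by_contra hX
  rw [not_nonempty_iff] at hX
  have hA : Subsingleton D.A := by
    refine ⟨fun a b => ?_⟩
    have hab : (Quot.mk _ a : D.Piece) = Quot.mk _ b := hc.elim _ _
    have h := Quot.eqvGen_exact hab
    induction h with
    | rel _ _ h => exact hX.elim h.choose
    | refl => rfl
    | symm _ _ _ ih => exact (ih (hc.elim _ _)).symm
    | trans _ _ _ _ _ ih1 ih2 => exact (ih1 (hc.elim _ _)).trans (ih2 (hc.elim _ _))
  obtain ⟨a⟩ := D.nonempty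
  refine hne (Quot.sound (Or.inl ⟨Equiv.equivOfIsEmpty D.X Empty, ?_, fun _ => 0,
    fun v => hX.elim v, fun v => hX.elim v⟩))
  have : Unique D.A := ⟨⟨a⟩, fun b => Subsingleton.elim b a⟩
  exact Equiv.ofUnique D.A Unit

theorem LinkDiagram.linked_of_isConnected {D : LinkDiagram} (hc : D.IsConnected) : D.Linked := by
  set r : D.X → D.X → Prop := fun a b => ∃ d : D.Dart, d.1 = a ∧ (D.mate d).1 = b with hr
  have hsymm : Std.Symm r := ⟨fun a b ⟨d, h1, h2⟩ => ⟨D.mate d, h2, by simpa using h1⟩⟩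
  have hstep : ∀ d e : D.Dart, D.arc d = D.arc e → Relation.ReflTransGen r d.1 e.1 := by
    intro d e h
    by_cases hde : e = d
    · rw [hde]
    · exact Relation.ReflTransGen.single ⟨d, rfl, by rw [← D.eq_mate d e hde h.symm]⟩
  -- An arc without ends is related only to itself. Recording that both arcs otherwise have ends
  -- provides the intermediate half-edge for transitivity.
  have key : ∀ a b, Relation.EqvGen (fun a b => ∃ v i j, D.arc (v, i) = a ∧ D.arc (v, j) = b) a b →
      (a = b ∨ ((∃ d, D.arc d = a) ∧ ∃ d, D.arc d = b) ∧
        ∀ d e, D.arc d = a → D.arc e = b → Relation.ReflTransGen r d.1 e.1) := by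
    intro a b h
    induction h with
    | rel _ _ h =>
      obtain ⟨v, i, j, rfl, rfl⟩ := h
      exact Or.inr ⟨⟨⟨_, rfl⟩, ⟨_, rfl⟩⟩, fun d e hd he =>
        (hstep d (v, i) hd).trans (hstep (v, j) e he.symm)⟩
    | refl => exact Or.inl rfl
    | symm _ _ _ ih =>
      refine ih.imp Eq.symm fun h => ⟨h.1.symm, fun d e hd he => ?_⟩
      exact (Relation.ReflTransGen.stdSymm (r := r)).symm _ _ (h.2 e d he hd)
    | trans _ _ _ _ _ ih1 ih2 =>
      rcases ih1 with rfl | ih1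
      · exact ih2
      rcases ih2 with rfl | ih2
      · exact Or.inr ih1
      obtain ⟨g, hg⟩ := ih1.1.2
      exact Or.inr ⟨⟨ih1.1.1, ih2.1.2⟩, fun d e hd he => (ih1.2 d g hd hg).trans (ih2.2 g e hg he)⟩
  intro u v
  have hab : (Quot.mk _ (D.arc (u, 0)) : D.Piece) = Quot.mk _ (D.arc (v, 0)) := hc.elim _ _
  rcases key _ _ (Quot.eqvGen_exact hab) with h | h
  · exact hstep _ _ h
  · exact h.2 _ _ rfl rfl

/-- There is one graph component, so Euler's formula becomes `F = V + 2`, as the dimension count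
requires. -/
theorem LinkDiagram.hasSides_of_linked {D : LinkDiagram} (hl : D.Linked) (hX : Nonempty D.X) :
    D.HasSides := by
  have hle : Nat.card D.GraphComponent = 1 := by
    obtain ⟨v₀⟩ := hX
    rw [Nat.card_eq_one_iff_exists]
    refine ⟨Quot.mk _ v₀, ?_⟩
    rintro ⟨u⟩
    induction hl v₀ u with
    | refl => rfl
    | tail _ h ih =>
      obtain ⟨d, rfl, rfl⟩ := h
      refine Eq.trans (Quot.sound ⟨(D.mate d).2, d.2, D.arc_mate d⟩) ih
  have hcard := D.planar
  rw [hle, mul_one] at hcard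
  exact fun c n hcn => hcn.exists_isSide hl hX hcard

/-- Every reduced alternating diagram of a prime alternating link other than the unknot has a
minimal 2-region. -/
theorem mainTheorem4 (L : Link) (hprime : L.IsPrime) (halt : L.IsAlternating)
    (hne : L ≠ Link.unknot) (D : LinkDiagram) (hD : D.link = L)
    (hDred : D.IsReduced) (hDalt : D.IsAlternating) :
    ∃ H : Set D.Dart, D.IsMinimalTwoRegion H := by
  have hc : D.IsConnected := by
    by_contra h
    exact hprime.1 ⟨D, hD, h⟩
  have hX := LinkDiagram.nonempty_of_ne_unknot hc (hD ▸ hne)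
  have hl := LinkDiagram.linked_of_isConnected hc
  obtain ⟨v⟩ := hX
  refine PDCode.exists_minimal_twoRegion (LinkDiagram.hasSides_of_linked hl ⟨v⟩) hl (v, 0) ?_
  exact fun d h => hDred d.1 ⟨d.2, h⟩
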